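/- **Conventions.** All Hilbert spaces are finite-dimensional and all logarithms are to base $2$; $\|A\|_{\mathrm{tr}}=\operatorname{tr}\sqrt{A^\dagger A}$; $H$ is Shannon entropy. A *QSR scheme with quantum keys* $\mathbb T=(P_{\mathcal K},\{\rho_k\}_{k\in\mathcal K},\mathcal E)$ consists of a probability distribution $P_{\mathcal K}$ on a finite set $\mathcal K$ of decryption keys, density operators $\rho_k\in\mathcal B(\mathcal H_K)$ (encryption keys) and a CPTP map $\mathcal E:\mathcal B(\mathcal H_K\otimes\mathcal H_S)\to\mathcal B(\mathcal H_C)$; the cipher of $\sigma$ is $\rho_{k,\sigma}=\mathcal E(\rho_k\otimes\sigma)$, the message dimension is $\dim\mathcal H_S$, and $H(\mathcal K)$ is the entropy of $P_{\mathcal K}$. It is - *invertible* if for each $k$ with $P_{\mathcal K}(k)>0$ some CPTP map $\mathcal D_k$ satisfies $\mathcal D_k(\rho_{k,\sigma})=\sigma$ for all density operators $\sigma$; - *$(t,\epsilon)$-randomizing* if there is a density operator $\tau$ with $\bigl\|\sum_kP_{\mathcal K}(k)\,\rho_{k,\sigma_1}\otimes\cdots\otimes\rho_{k,\sigma_t}-\tau\bigr\|_{\mathrm{tr}}\le\epsilon$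 for all density operators $\sigma_1,\dots,\sigma_t$; - *$(t,\epsilon)$-indistinguishable* if for all $t_1+t_2=t$ there is a density operator $\tau$ with $\bigl\|\sum_kP_{\mathcal K}(k)\,\rho_{k,\sigma_1}\otimes\cdots\otimes\rho_{k,\sigma_{t_1}}\otimes\rho_k^{\otimes t_2}-\tau\bigr\|_{\mathrm{tr}}\le\epsilon$ for all density operators $\sigma_1,\dots,\sigma_{t_1}$. A *one-time pad with $m$-bit key* in dimension $d$ is a probability distribution $P$ on $\{0,1\}^m$ with CPTP maps $\mathcal F_s:\mathcal B(\mathbb C^d)\to\mathcal B(\mathcal H_D)$, $s\in\{0,1\}^m$. It is invertible if each $\mathcal F_s$ with $P(s)>0$ has a CPTP left inverse on density operators, and $(1,\epsilon)$-randomizing if for some density operator $\tau$, $\bigl\|\sum_sP(s)\mathcal F_s(\sigma)-\tau\bigr\|_{\mathrm{tr}}\le\epsilon$ for all density operators $\sigma$. **The combined scheme.** The decryption key is a uniformly random matrix $A\in\{0,1\}^{m\times n}$; the encryption key is $\rho_A=2^{-n}\sum_{x\in\{0,1\}^n}|Ax,x\rangle\langle Ax,x|$. For classical messages $s\in\{0,1\}^m$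 let $\mathcal E$ apply $\sum_{x,s,y}|y\oplus s,x\rangle\langle y,x|\otimes|s\rangle\langle s|$ to key and message and trace out the message system. For a one-time pad $(P,\{\mathcal F_s\})$ with $m$-bit key in dimension $d$, the combined scheme has keys $A$, $\rho_A$ and encrypts $\sigma\in\mathcal B(\mathbb C^d)$ by $$\mathcal G(\rho_A\otimes\sigma)=\sum_{s}P(s)\,\mathcal E(\rho_A\otimes|s\rangle\langle s|)\otimes\mathcal F_s(\sigma).$$ **Theorem.** 1. Let $d\ge1$, $t<n$, $\epsilon_1=2^{t-n+1}$. If the pad is invertible and $(1,\epsilon_2)$-randomizing, then the combined scheme is invertible, $(t,\epsilon_1+t\epsilon_2)$-randomizing and $(t,\epsilon_1+t\epsilon_2)$-indistinguishable for all messages of dimension $d$, all its encryption keys are diagonal in the computational basis (that is, classical), and $H(\mathcal K)=\bigl(t+\log\frac1{\epsilon_1}+1\bigr)m$. 2. Let $d\ge1$, $\epsilon_1,\epsilon_2>0$, and suppose that $n=t+\log\frac1{\epsilon_1}+1$ and $m=\log d+2\log\frac1{\epsilon_2}+4$ are natural numbers, with $t<n$. Then there is an invertible $(1,\epsilon_2)$-randomizing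 one-time pad with uniform $m$-bit key in dimension $d$ whose combined scheme has all the properties in 1 and $$H(\mathcal K)=\Bigl(t+\log\tfrac1{\epsilon_1}+1\Bigr)\Bigl(\log d+2\log\tfrac1{\epsilon_2}+4\Bigr).$$ 3. Every invertible QSR scheme with quantum keys and message dimension $d\ge1$ that is $(t,\epsilon)$-randomizing or $(t,\epsilon)$-indistinguishable satisfies $H(\mathcal K)\ge(1-8\epsilon)\,t\log d-2$. 4. Let $t\to\infty$ and $d\to\infty$ (along any filter), and let $\epsilon_1,\epsilon_2>0$ vary with $\log\frac1{\epsilon_1}=o(t)$ and $\log\frac1{\epsilon_2}=o(\log d)$ (for instance, $\epsilon_1$ and $\epsilon_2$ polynomial in $\frac1t$ and $\frac1{\log d}$ respectively). Then, eventually, there are $n,m$ and an invertible $(1,\epsilon_2)$-randomizing one-time pad with uniform $m$-bit key in dimension $d$ such that the combined scheme is invertible, $(t,\epsilon_1+t\epsilon_2)$-randomizing and $(t,\epsilon_1+t\epsilon_2)$-indistinguishable, uses only classical encryption keys, and has $$H(\mathcal K)=t\log d+o(t\log d).$$ If moreover $\epsilon:=\epsilon_1+t\epsilon_2\to0$, then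 $H(\mathcal K)\big/\bigl((1-8\epsilon)\,t\log d-2\bigr)\to1$: the scheme asymptotically attains the lower bound of 3. -/

import Mathlib

open Filter Topology Asymptotics
open scoped Kronecker ComplexOrder

namespace QKey

/-! Finite-dimensional Hilbert spaces are `ℂ^ι` with a finite index type `ι` (the computational
basis), operators are matrices, and `ℂ^ι ⊗ ℂ^κ` is `ℂ^(ι × κ)`. All logarithms are to base 2. -/

section Basics

variable {ι κ μ : Type} [Fintype ι] [DecidableEq ι] [Fintype κ] [DecidableEq κ]
  [Fintype μ] [DecidableEq μ]

/-- Density operators. -/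
def IsDensity (ρ : Matrix ι ι ℂ) : Prop := ρ.PosSemidef ∧ ρ.trace = 1

/-- The trace norm `tr √(Aᴴ A)`: the sum of the singular values of `A`, i.e. of the square roots of
the eigenvalues of `Aᴴ A`. -/
noncomputable def trNorm (A : Matrix ι ι ℂ) : ℝ :=
  ∑ i, Real.sqrt ((Matrix.isHermitian_conjTranspose_mul_self A).eigenvalues i)

/-- Completely positive trace-preserving maps, through the operator-sum (Kraus)
representation. -/
def IsCPTP (Φ : Matrix ι ι ℂ →ₗ[ℂ] Matrix κ κ ℂ) : Prop :=
  ∃ (r : Type) (_ : Fintype r) (V : r → Matrix κ ι ℂ),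
    (∀ X, Φ X = ∑ a, V a * X * (V a).conjTranspose) ∧
      ∑ a, (V a).conjTranspose * V a = 1

/-- The basis projector `|s⟩⟨s|`. -/
def proj (s : ι) : Matrix ι ι ℂ := Matrix.single s s 1

/-- The tensor product `M 0 ⊗ ⋯ ⊗ M (t - 1)` of `t` operators on `ℂ^ι`, acting on
`(ℂ^ι)^{⊗ t} = ℂ^(Fin t → ι)`. -/
def tensorPow {t : ℕ} (M : Fin t → Matrix ι ι ℂ) : Matrix (Fin t → ι) (Fin t → ι) ℂ :=
  Matrix.of fun a b => ∏ i, M i (a i) (b i)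

/-- The partial trace over the second tensor factor. -/
def ptraceRight : Matrix (ι × κ) (ι × κ) ℂ →ₗ[ℂ] Matrix ι ι ℂ where
  toFun X := Matrix.of fun a b => ∑ c, X (a, c) (b, c)
  map_add' X Y := by ext a b; simp [Finset.sum_add_distrib]
  map_smul' z X := by ext a b; simp [Finset.mul_sum]

/-- Shannon entropy (in bits) of a distribution on a finite set. -/
noncomputable def entropy (p : κ → ℝ) : ℝ := ∑ k, p k * Real.logb 2 (1 / p k)

theorem isCPTP_ptraceRight_conj (U : Matrix (ι × κ) (ι × κ) ℂ) (hU : U.conjTranspose * U = 1)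
    (Φ : Matrix (ι × κ) (ι × κ) ℂ →ₗ[ℂ] Matrix ι ι ℂ)
    (hΦ : ∀ X, Φ X = ptraceRight (U * X * U.conjTranspose)) : IsCPTP Φ := by
  let P : κ → Matrix ι (ι × κ) ℂ := fun c => Matrix.of fun a b => if (a, c) = b then 1 else 0
  have hP : ∀ (c : κ) (Y : Matrix (ι × κ) (ι × κ) ℂ) (a b : ι),
      (P c * Y * (P c).conjTranspose) a b = Y (a, c) (b, c) := by
    intro c Y a b
    simp [P, Matrix.mul_apply, Matrix.conjTranspose_apply, apply_ite]
  have hPP : ∑ c, (P c).conjTranspose * P c = 1 := by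
    ext ⟨a, c⟩ ⟨b, e⟩
    simp only [P, Matrix.sum_apply, Matrix.mul_apply, Matrix.conjTranspose_apply, Matrix.of_apply,
      Matrix.one_apply, Prod.mk.injEq]
    by_cases hab : a = b <;> by_cases hce : c = e <;> simp [hab, hce, ite_and]
    all_goals grind
  refine ⟨κ, inferInstance, fun c => P c * U, fun X => ?_, ?_⟩
  · rw [hΦ]
    ext a b
    rw [Matrix.sum_apply]
    refine Finset.sum_congr rfl fun c _ => ?_
    have h := hP c (U * X * U.conjTranspose) a b
    rw [Matrix.conjTranspose_mul]
    simp only [Matrix.mul_assoc] at h ⊢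
    exact h.symm
  · calc ∑ c, (P c * U).conjTranspose * (P c * U)
        = U.conjTranspose * (∑ c, (P c).conjTranspose * P c) * U := by
          simp only [Matrix.conjTranspose_mul, Matrix.mul_sum, Matrix.sum_mul, Matrix.mul_assoc]
      _ = 1 := by rw [hPP, Matrix.mul_one, hU]

/-- The tensor product `Φ ⊗ Ψ` of linear maps on operators. -/
noncomputable def mapTensor {ι' κ' : Type}
    (Φ : Matrix ι ι ℂ →ₗ[ℂ] Matrix ι' ι' ℂ) (Ψ : Matrix κ κ ℂ →ₗ[ℂ] Matrix κ' κ' ℂ) :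
    Matrix (ι × κ) (ι × κ) ℂ →ₗ[ℂ] Matrix (ι' × κ') (ι' × κ') ℂ where
  toFun X := ∑ i, ∑ i', ∑ j, ∑ j', X (i, j) (i', j') •
    (Φ (Matrix.single i i' 1) ⊗ₖ Ψ (Matrix.single j j' 1))
  map_add' X Y := by simp only [Matrix.add_apply, add_smul, Finset.sum_add_distrib]
  map_smul' z X := by
    simp only [Matrix.smul_apply, smul_assoc, Finset.smul_sum, RingHom.id_apply]

theorem mapTensor_kronecker {ι' κ' : Type}
    (Φ : Matrix ι ι ℂ →ₗ[ℂ] Matrix ι' ι' ℂ) (Ψ : Matrix κ κ ℂ →ₗ[ℂ] Matrix κ' κ' ℂ)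
    (A : Matrix ι ι ℂ) (B : Matrix κ κ ℂ) : mapTensor Φ Ψ (A ⊗ₖ B) = Φ A ⊗ₖ Ψ B := by
  have hA : Φ A = ∑ i, ∑ i', A i i' • Φ (Matrix.single i i' 1) := by
    conv_lhs => rw [Matrix.matrix_eq_sum_single A]
    simp only [map_sum, ← map_smul, Matrix.smul_single, smul_eq_mul, mul_one]
  have hB : Ψ B = ∑ j, ∑ j', B j j' • Ψ (Matrix.single j j' 1) := by
    conv_lhs => rw [Matrix.matrix_eq_sum_single B]
    simp only [map_sum, ← map_smul, Matrix.smul_single, smul_eq_mul, mul_one]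
  rw [hA, hB]
  ext ⟨a, b⟩ ⟨a', b'⟩
  simp only [mapTensor, LinearMap.coe_mk, AddHom.coe_mk, Matrix.kroneckerMap_apply,
    Matrix.sum_apply, Matrix.smul_apply, smul_eq_mul]
  rw [Finset.sum_mul]
  refine Finset.sum_congr rfl fun i _ => ?_
  rw [Finset.sum_mul]
  refine Finset.sum_congr rfl fun i' _ => ?_
  rw [Finset.mul_sum]
  refine Finset.sum_congr rfl fun j _ => ?_
  rw [Finset.mul_sum]
  refine Finset.sum_congr rfl fun j' _ => ?_
  ring

theorem mapTensor_kraus {ι' κ' r q : Type} [Fintype r] [Fintype q]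
    (Φ : Matrix ι ι ℂ →ₗ[ℂ] Matrix ι' ι' ℂ) (Ψ : Matrix κ κ ℂ →ₗ[ℂ] Matrix κ' κ' ℂ)
    (V : r → Matrix ι' ι ℂ) (W : q → Matrix κ' κ ℂ)
    (hV : ∀ X, Φ X = ∑ a, V a * X * (V a).conjTranspose)
    (hW : ∀ X, Ψ X = ∑ b, W b * X * (W b).conjTranspose) (X : Matrix (ι × κ) (ι × κ) ℂ) :
    mapTensor Φ Ψ X = ∑ a, ∑ b, (V a ⊗ₖ W b) * X * (V a ⊗ₖ W b).conjTranspose := by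
  have hX : X = ∑ i, ∑ i', ∑ j, ∑ j', X (i, j) (i', j') •
      ((Matrix.single i i' (1 : ℂ)) ⊗ₖ (Matrix.single j j' (1 : ℂ))) := by
    ext ⟨a, b⟩ ⟨a', b'⟩
    simp [Matrix.sum_apply, Matrix.single_apply, ite_and]
  have key : ∀ (A : Matrix ι ι ℂ) (B : Matrix κ κ ℂ), Φ A ⊗ₖ Ψ B =
      ∑ a, ∑ b, (V a ⊗ₖ W b) * (A ⊗ₖ B) * (V a ⊗ₖ W b).conjTranspose := by
    intro A B
    rw [hV, hW]
    simp only [Matrix.conjTranspose_kronecker, ← Matrix.mul_kronecker_mul]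
    ext ⟨a, b⟩ ⟨a', b'⟩
    simp only [Matrix.kroneckerMap_apply, Matrix.sum_apply, Finset.sum_mul, Finset.mul_sum]
    exact Finset.sum_comm
  let L : Matrix (ι × κ) (ι × κ) ℂ →ₗ[ℂ] Matrix (ι' × κ') (ι' × κ') ℂ :=
    { toFun := fun Y => ∑ a, ∑ b, (V a ⊗ₖ W b) * Y * (V a ⊗ₖ W b).conjTranspose
      map_add' := fun Y Z => by
        simp only [Matrix.mul_add, Matrix.add_mul, Finset.sum_add_distrib]
      map_smul' := fun z Y => by
        simp only [Matrix.mul_smul, Matrix.smul_mul, Finset.smul_sum, RingHom.id_apply] }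
  change mapTensor Φ Ψ X = L X
  have h1 : L X = ∑ i, ∑ i', ∑ j, ∑ j', X (i, j) (i', j') •
      L ((Matrix.single i i' (1 : ℂ)) ⊗ₖ (Matrix.single j j' (1 : ℂ))) := by
    conv_lhs => rw [hX]
    simp only [map_sum, map_smul]
  rw [h1]
  simp only [mapTensor, LinearMap.coe_mk, AddHom.coe_mk]
  refine Finset.sum_congr rfl fun i _ => Finset.sum_congr rfl fun i' _ =>
    Finset.sum_congr rfl fun j _ => Finset.sum_congr rfl fun j' _ => ?_
  rw [key]
  rfl

end Basics

/-! ### Schemes -/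

/-- A quantum state randomization scheme with quantum encryption keys: decryption keys `k : κ`
chosen with probability `prob k`, encryption keys `key k` on `ℂ^K`, and an encryption operator
`enc` from operators on `ℂ^K ⊗ ℂ^S` to operators on `ℂ^C`. -/
structure QSR (κ K S C : Type) [Fintype κ] [Fintype K] [DecidableEq K] [Fintype S] [DecidableEq S]
    [Fintype C] [DecidableEq C] where
  prob : κ → ℝ
  prob_nonneg : ∀ k, 0 ≤ prob k
  prob_sum : ∑ k, prob k = 1
  key : κ → Matrix K K ℂ
  key_density : ∀ k, IsDensity (key k)
  enc : Matrix (K × S) (K × S) ℂ →ₗ[ℂ] Matrix C C ℂ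
  enc_cptp : IsCPTP enc

/-- A quantum state randomization scheme with classical keys `s : S`, chosen with probability
`prob s`: the message on `ℂ^R` is encrypted by the CPTP map `enc s`, with cipher on `ℂ^D`. -/
structure ClassicalKeyQSR (S R D : Type) [Fintype S] [Fintype R] [DecidableEq R] [Fintype D]
    [DecidableEq D] where
  prob : S → ℝ
  prob_nonneg : ∀ s, 0 ≤ prob s
  prob_sum : ∑ s, prob s = 1
  enc : S → (Matrix R R ℂ →ₗ[ℂ] Matrix D D ℂ)
  enc_cptp : ∀ s, IsCPTP (enc s)

namespace QSR

variable {κ K S C : Type} [Fintype κ] [Fintype K] [DecidableEq K] [Fintype S] [DecidableEq S]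
  [Fintype C] [DecidableEq C]

/-- The cipher of the message `σ` under the key `k`. -/
def cipher (T : QSR κ K S C) (k : κ) (σ : Matrix S S ℂ) : Matrix C C ℂ := T.enc (T.key k ⊗ₖ σ)

/-- The entropy of the decryption key. -/
noncomputable def keyEntropy (T : QSR κ K S C) : ℝ := entropy T.prob

/-- Whoever knows `k` can decrypt every density operator message. -/
def Invertible (T : QSR κ K S C) : Prop :=
  ∀ k, 0 < T.prob k → ∃ D : Matrix C C ℂ →ₗ[ℂ] Matrix S S ℂ, IsCPTP D ∧
    ∀ σ, IsDensity σ → D (T.cipher k σ) = σ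

/-- `(t, ε)`-randomizing for all density operator messages. -/
def Randomizing (T : QSR κ K S C) (t : ℕ) (ε : ℝ) : Prop :=
  ∃ τ : Matrix (Fin t → C) (Fin t → C) ℂ, IsDensity τ ∧
    ∀ σ : Fin t → Matrix S S ℂ, (∀ i, IsDensity (σ i)) →
      trNorm (∑ k, (T.prob k : ℂ) • tensorPow (fun i => T.cipher k (σ i)) - τ) ≤ ε

/-- `(t, ε)`-indistinguishable for all density operator messages: of `t` copies of the encryption
key, `t₁` were used to encrypt messages and the adversary holds the ciphers and the other `t₂`
copies. -/
def Indistinguishable (T : QSR κ K S C) (t : ℕ) (ε : ℝ) : Prop :=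
  ∀ t₁ t₂ : ℕ, t₁ + t₂ = t →
    ∃ τ : Matrix ((Fin t₁ → C) × (Fin t₂ → K)) ((Fin t₁ → C) × (Fin t₂ → K)) ℂ, IsDensity τ ∧
      ∀ σ : Fin t₁ → Matrix S S ℂ, (∀ i, IsDensity (σ i)) →
        trNorm (∑ k, (T.prob k : ℂ) •
          (tensorPow (fun i => T.cipher k (σ i)) ⊗ₖ tensorPow (fun _ : Fin t₂ => T.key k)) - τ) ≤ ε

/-- All encryption keys are diagonal in the computational basis, that is, classical. -/
def ClassicalKeys (T : QSR κ K S C) : Prop := ∀ k, (T.key k).IsDiag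

end QSR

namespace ClassicalKeyQSR

variable {S R D : Type} [Fintype S] [Fintype R] [DecidableEq R] [Fintype D] [DecidableEq D]

/-- Whoever knows `s` can decrypt every density operator message. -/
def Invertible (P : ClassicalKeyQSR S R D) : Prop :=
  ∀ s, 0 < P.prob s → ∃ Dec : Matrix D D ℂ →ₗ[ℂ] Matrix R R ℂ, IsCPTP Dec ∧
    ∀ σ, IsDensity σ → Dec (P.enc s σ) = σ

/-- `(1, ε)`-randomizing for all density operator messages. -/
def Randomizing (P : ClassicalKeyQSR S R D) (ε : ℝ) : Prop :=
  ∃ τ : Matrix D D ℂ, IsDensity τ ∧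
    ∀ σ, IsDensity σ → trNorm (∑ s, (P.prob s : ℂ) • P.enc s σ - τ) ≤ ε

/-- The key is uniformly distributed. -/
def UniformKey (P : ClassicalKeyQSR S R D) : Prop := ∀ s, P.prob s = 1 / (Fintype.card S : ℝ)

end ClassicalKeyQSR

/-! ### The scheme for classical messages -/

section ClassicalScheme

variable (m n : ℕ)

/-- Bit strings of length `n`, as vectors over the field with two elements. -/
abbrev Bits (n : ℕ) : Type := Fin n → ZMod 2

/-- The encryption key `ρ_A = 2⁻ⁿ ∑ₓ |Ax, x⟩⟨Ax, x|`. -/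
noncomputable def linKey (A : Matrix (Fin m) (Fin n) (ZMod 2)) :
    Matrix (Bits m × Bits n) (Bits m × Bits n) ℂ :=
  (1 / 2 ^ n : ℂ) • ∑ x : Bits n, proj (A.mulVec x, x)

/-- The unitary `U = ∑_{x,s,y} |y ⊕ s, x⟩⟨y, x| ⊗ |s⟩⟨s|`. -/
def shiftU : Matrix ((Bits m × Bits n) × Bits m) ((Bits m × Bits n) × Bits m) ℂ :=
  ∑ x : Bits n, ∑ s : Bits m, ∑ y : Bits m,
    Matrix.single (y + s, x) (y, x) 1 ⊗ₖ Matrix.single s s 1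

/-- The encryption operator: apply `U` and trace out the message system. -/
def shiftEnc : Matrix ((Bits m × Bits n) × Bits m) ((Bits m × Bits n) × Bits m) ℂ →ₗ[ℂ]
    Matrix (Bits m × Bits n) (Bits m × Bits n) ℂ where
  toFun X := ptraceRight (shiftU m n * X * (shiftU m n).conjTranspose)
  map_add' X Y := by simp [Matrix.mul_add, Matrix.add_mul]
  map_smul' z X := by simp

theorem linKey_density (A : Matrix (Fin m) (Fin n) (ZMod 2)) : IsDensity (linKey m n A) := by
  constructor
  · have h : (0 : ℂ) ≤ 1 / 2 ^ n := by simp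
    refine Matrix.PosSemidef.smul (Matrix.posSemidef_sum _ fun x _ => ?_) h
    have : proj (A.mulVec x, x) = (proj (A.mulVec x, x)).conjTranspose * proj (A.mulVec x, x) := by
      simp [proj]
    rw [this]
    exact Matrix.posSemidef_conjTranspose_mul_self _
  · simp [linKey, proj, Matrix.trace_sum]

theorem shiftU_unitary : (shiftU m n).conjTranspose * shiftU m n = 1 := by
  have h : ∀ i j, shiftU m n i j =
      if i = ((j.1.1 + j.2, j.1.2), j.2) then 1 else 0 := by
    rintro ⟨⟨y', x'⟩, s'⟩ ⟨⟨y, x⟩, s⟩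
    simp only [shiftU, Matrix.sum_apply, Matrix.kroneckerMap_apply, Matrix.single_apply,
      Prod.mk.injEq]
    rw [Finset.sum_eq_single x, Finset.sum_eq_single s, Finset.sum_eq_single y]
    · by_cases h1 : y' = y + s <;> by_cases h2 : x' = x <;> by_cases h3 : s' = s <;>
        simp [h1, h2, h3, eq_comm]
    · intro b _ hb; simp [hb]
    · simp
    · intro b _ hb; simp [hb]
    · simp
    · intro b _ hb; simp [hb]
    · simp
  ext ⟨⟨y', x'⟩, s'⟩ ⟨⟨y, x⟩, s⟩
  simp only [Matrix.mul_apply, Matrix.conjTranspose_apply, h, Matrix.one_apply]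
  by_cases h1 : ((y', x'), s') = ((y, x), s)
  · obtain ⟨⟨rfl, rfl⟩, rfl⟩ : (y' = y ∧ x' = x) ∧ s' = s := by simpa using h1
    simp
  · rw [if_neg h1]
    refine Finset.sum_eq_zero fun j _ => ?_
    by_cases h2 : j = ((y' + s', x'), s')
    · subst h2
      suffices h4 : ¬ ((y' + s', x'), s') = ((y + s, x), s) by simp only [if_neg h4, mul_zero]
      intro h3
      apply h1
      simp only [Prod.mk.injEq] at h3 ⊢
      obtain ⟨⟨h4, h5⟩, h6⟩ := h3
      subst h6
      exact ⟨⟨add_right_cancel h4, h5⟩, rfl⟩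
    · simp [h2]

/-- The scheme for classical messages of `m` bits: the decryption key is a uniformly random
`m × n` binary matrix. -/
noncomputable def linScheme :
    QSR (Matrix (Fin m) (Fin n) (ZMod 2)) (Bits m × Bits n) (Bits m) (Bits m × Bits n) where
  prob _ := 1 / (Fintype.card (Matrix (Fin m) (Fin n) (ZMod 2)) : ℝ)
  prob_nonneg _ := by positivity
  prob_sum := by simp
  key := linKey m n
  key_density := linKey_density m n
  enc := shiftEnc m n
  enc_cptp := isCPTP_ptraceRight_conj (shiftU m n) (shiftU_unitary m n) _ fun _ => rfl

end ClassicalScheme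

/-! ### The combined scheme -/

section Combine

variable {κ K S C R D : Type} [Fintype κ] [Fintype K] [DecidableEq K] [Fintype S] [DecidableEq S]
  [Fintype C] [DecidableEq C] [Fintype R] [DecidableEq R] [Fintype D] [DecidableEq D]

/-- The map `Y ↦ E (Y ⊗ |s⟩⟨s|)`. -/
noncomputable def encBasis (E : Matrix (K × S) (K × S) ℂ →ₗ[ℂ] Matrix C C ℂ) (s : S) :
    Matrix K K ℂ →ₗ[ℂ] Matrix C C ℂ where
  toFun Y := E (Y ⊗ₖ proj s)
  map_add' Y Z := by rw [Matrix.add_kronecker, map_add]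
  map_smul' z Y := by rw [Matrix.smul_kronecker, map_smul, RingHom.id_apply]

/-- The encryption operator `G` of the combined scheme: choose a classical key `s`, encrypt the
message with `F_s` and encrypt `|s⟩⟨s|` with the first scheme, that is,
`G (ρ ⊗ σ) = ∑ s, P s • E (ρ ⊗ |s⟩⟨s|) ⊗ F_s σ`. -/
noncomputable def combineEnc (T : QSR κ K S C) (P : ClassicalKeyQSR S R D) :
    Matrix (K × R) (K × R) ℂ →ₗ[ℂ] Matrix (C × D) (C × D) ℂ :=
  ∑ s, (P.prob s : ℂ) • mapTensor (encBasis T.enc s) (P.enc s)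

theorem combineEnc_kronecker (T : QSR κ K S C) (P : ClassicalKeyQSR S R D)
    (ρ : Matrix K K ℂ) (σ : Matrix R R ℂ) : combineEnc T P (ρ ⊗ₖ σ) =
      ∑ s, (P.prob s : ℂ) • (T.enc (ρ ⊗ₖ proj s) ⊗ₖ P.enc s σ) := by
  simp [combineEnc, mapTensor_kronecker, encBasis]

theorem combineEnc_cptp (T : QSR κ K S C) (P : ClassicalKeyQSR S R D) :
    IsCPTP (combineEnc T P) := by
  obtain ⟨r, _, V, hV, hV1⟩ := T.enc_cptp
  choose q hq W hW hW1 using P.enc_cptp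
  let V' : S → r → Matrix C K ℂ := fun s a => Matrix.of fun c k => V a c (k, s)
  have hV' : ∀ s X, encBasis T.enc s X = ∑ a, V' s a * X * (V' s a).conjTranspose := by
    intro s X
    change T.enc (X ⊗ₖ proj s) = _
    rw [hV]
    refine Finset.sum_congr rfl fun a _ => ?_
    ext c c'
    simp [V', proj, Matrix.mul_apply, Fintype.sum_prod_type, Matrix.single_apply, ite_and]
  have hV1' : ∀ s, ∑ a, (V' s a).conjTranspose * V' s a = 1 := by
    intro s
    ext k k'
    have := congrFun (congrFun hV1 (k, s)) (k', s)
    simp only [Matrix.sum_apply, Matrix.mul_apply, Matrix.conjTranspose_apply, Matrix.one_apply,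
      Prod.mk.injEq, and_true] at this
    simpa [V', Matrix.sum_apply, Matrix.mul_apply, Matrix.one_apply] using this
  have hsq : ∀ s, ((Real.sqrt (P.prob s) : ℝ) : ℂ) * ((Real.sqrt (P.prob s) : ℝ) : ℂ)
      = (P.prob s : ℂ) := fun s => by
    rw [← Complex.ofReal_mul, Real.mul_self_sqrt (P.prob_nonneg s)]
  refine ⟨(s : S) × (r × q s), inferInstance,
    fun x => ((Real.sqrt (P.prob x.1) : ℝ) : ℂ) • (V' x.1 x.2.1 ⊗ₖ W x.1 x.2.2), fun X => ?_, ?_⟩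
  · rw [Fintype.sum_sigma]
    simp only [combineEnc, LinearMap.sum_apply, LinearMap.smul_apply]
    refine Finset.sum_congr rfl fun s _ => ?_
    rw [mapTensor_kraus _ _ (V' s) (W s) (hV' s) (hW s), Fintype.sum_prod_type, Finset.smul_sum]
    refine Finset.sum_congr rfl fun a _ => ?_
    rw [Finset.smul_sum]
    refine Finset.sum_congr rfl fun b _ => ?_
    simp only [Matrix.conjTranspose_smul, Matrix.smul_mul, Matrix.mul_smul, smul_smul]
    rw [← hsq s]
    simp
  · rw [Fintype.sum_sigma]
    have : ∀ s, ∑ x : r × q s,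
        (((Real.sqrt (P.prob s) : ℝ) : ℂ) • (V' s x.1 ⊗ₖ W s x.2)).conjTranspose *
          (((Real.sqrt (P.prob s) : ℝ) : ℂ) • (V' s x.1 ⊗ₖ W s x.2)) =
        (P.prob s : ℂ) • (1 : Matrix (K × R) (K × R) ℂ) := by
      intro s
      have h1 : (1 : Matrix (K × R) (K × R) ℂ) =
          ∑ x : r × q s, (V' s x.1 ⊗ₖ W s x.2).conjTranspose * (V' s x.1 ⊗ₖ W s x.2) := by
        rw [← Matrix.one_kronecker_one, ← hV1' s, ← hW1 s, Fintype.sum_prod_type]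
        simp only [Matrix.conjTranspose_kronecker, ← Matrix.mul_kronecker_mul]
        ext ⟨a, b⟩ ⟨a', b'⟩
        simp only [Matrix.kroneckerMap_apply, Matrix.sum_apply, Finset.sum_mul, Finset.mul_sum]
        exact Finset.sum_comm
      rw [h1, Finset.smul_sum]
      refine Finset.sum_congr rfl fun x _ => ?_
      simp only [Matrix.conjTranspose_smul, Matrix.smul_mul, Matrix.mul_smul, smul_smul]
      rw [← hsq s]
      simp
    rw [Finset.sum_congr rfl fun s _ => this s, ← Finset.sum_smul]
    rw [← Complex.ofReal_sum, P.prob_sum]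
    simp

/-- The combined scheme: the decryption and encryption keys are those of `T`. -/
noncomputable def combine (T : QSR κ K S C) (P : ClassicalKeyQSR S R D) :
    QSR κ K R (C × D) where
  prob := T.prob
  prob_nonneg := T.prob_nonneg
  prob_sum := T.prob_sum
  key := T.key
  key_density := T.key_density
  enc := combineEnc T P
  enc_cptp := combineEnc_cptp T P

end Combine

end QKey

set_option linter.unusedSectionVars false

namespace QKey

/-! ### Trace norm bounds through Jordan decompositions -/

section TraceNorm

variable {ι κ : Type} [Fintype ι] [DecidableEq ι] [Fintype κ] [DecidableEq κ]

/-! The security rests on one fact about random matrices. If `x₁, …, x_t` in `(ZMod 2)ⁿ` are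
linearly independent and `A` is uniform, then `A x₁, …, A x_t` are independent and uniform. Uniform
vectors are dependent with probability at most `2^(t-n)`, by a union bound over the coefficient
vectors of a possible relation. A key copy is a uniform sample `(A x, x)`, so `t` copies, used or
unused, differ by at most `2 * 2^(t-n)` in trace norm from samples with a fresh uniform `y` in place
of `A x` (`trLE_average_mulVec_sub`). A fresh `y` masks the pad key `s` perfectly. Each message then
sees the pad under an unknown key, which costs `ε₂` per encryption (`combine_indistinguishable`).
Whoever knows `A` reads `s` off the cipher.

The short pad applies `V (r s)`, where `V` enumerates a unitary design and the random function `r`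
is published with the cipher. The trace norm is then an average over `r`, so for each message
separately a second-moment bound suffices, with no net over messages (`designPad_randomizing`). It
needs only `4 d ≤ 2^m ε²`.

For the lower bound, encrypt the `N = d^t` classical messages. Each average cipher is close to one
state `τ`, and for a known key the ciphers of different messages are perfectly distinguished by a
measurement. Measuring `τ` with the square-root measurement of an average cipher yields a
sub-distribution on keys which, by the Powers-Størmer inequality, overlaps strongly with `P`
(`exists_overlap`). Averaged over the messages, the overlap comes from weights at most `1 / N`,
because the decoding effects of each key sum to `1`. Thus `P` puts mass at most `4 ε` on keys of
probability above `4 / N`, and the entropy bound follows (`le_entropy_of_overlap`). The asymptotic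
statement comes from rounding `n` and `m` up to natural numbers.

Trace norms are estimated through `TrLE`, a witness of the form `P - N` with `P` and `N` positive.
It passes directly through sums, tensor products and relabelling. -/

theorem exists_unitary_diagonalization {A : Matrix ι ι ℂ} (hA : A.IsHermitian) :
    ∃ U : Matrix ι ι ℂ, U.conjTranspose * U = 1 ∧ U * U.conjTranspose = 1 ∧
      A = U * Matrix.diagonal (fun i => (hA.eigenvalues i : ℂ)) * U.conjTranspose := by
  refine ⟨hA.eigenvectorUnitary, ?_, ?_, ?_⟩
  · exact Unitary.coe_star_mul_self _
  · exact Unitary.coe_mul_star_self _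
  · have := hA.spectral_theorem
    rw [Unitary.conjStarAlgAut_apply] at this
    exact this

theorem conj_eq_diagonal {A U D : Matrix ι ι ℂ} (hU : U.conjTranspose * U = 1)
    (hA : A = U * D * U.conjTranspose) : U.conjTranspose * A * U = D := by
  calc U.conjTranspose * A * U = (U.conjTranspose * U) * D * (U.conjTranspose * U) := by
        rw [hA]; simp only [Matrix.mul_assoc]
    _ = D := by rw [hU, Matrix.one_mul, Matrix.mul_one]

/-- The operator `Aᴴ A` is unitarily conjugate to the diagonal matrix of the squared eigenvalues of
`A`. Its own eigenvalues agree with these squares only up to order, so the roots of the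
characteristic polynomial are compared as multisets. -/
theorem trNorm_eq_sum_abs_eigenvalues {A : Matrix ι ι ℂ} (hA : A.IsHermitian) :
    trNorm A = ∑ i, |hA.eigenvalues i| := by
  obtain ⟨U, hU, hU', hd⟩ := exists_unitary_diagonalization hA
  have h1 : A.conjTranspose * A = U * Matrix.diagonal (fun i => ((hA.eigenvalues i ^ 2 : ℝ) : ℂ)) *
      U.conjTranspose := by
    rw [hA.eq]
    conv_lhs => rw [hd]
    have : ∀ D : Matrix ι ι ℂ, U * D * U.conjTranspose * (U * D * U.conjTranspose) =
        U * (D * D) * U.conjTranspose := by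
      intro D
      calc _ = U * D * (U.conjTranspose * U) * D * U.conjTranspose := by
            simp only [Matrix.mul_assoc]
        _ = _ := by rw [hU]; simp only [Matrix.mul_assoc, Matrix.one_mul]
    rw [this, Matrix.diagonal_mul_diagonal]
    simp [sq]
  have h2 := (Matrix.isHermitian_conjTranspose_mul_self A).roots_charpoly_eq_eigenvalues
  have h3 : (A.conjTranspose * A).charpoly.roots =
      Multiset.map (fun i => ((hA.eigenvalues i ^ 2 : ℝ) : ℂ)) Finset.univ.val := by
    rw [h1, Matrix.charpoly_mul_comm, ← Matrix.mul_assoc, hU, Matrix.one_mul,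
      Matrix.charpoly_diagonal, Polynomial.roots_prod]
    · simp [-Complex.ofReal_pow]
    · simp [Finset.prod_ne_zero_iff, Polynomial.X_sub_C_ne_zero, -Complex.ofReal_pow]
  rw [h2] at h3
  have h4 := congrArg (fun s : Multiset ℂ => (s.map fun z => Real.sqrt z.re).sum) h3
  simp only [Multiset.map_map, Function.comp_def] at h4
  simp only [Complex.ofReal_re, Real.sqrt_sq_eq_abs] at h4
  exact h4

/-- `A` has a decomposition into a difference of positive operators of total trace at most `c`;
for Hermitian `A` this says that the trace norm of `A` is at most `c`. -/
def TrLE (A : Matrix ι ι ℂ) (c : ℝ) : Prop :=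
  ∃ P N : Matrix ι ι ℂ, P.PosSemidef ∧ N.PosSemidef ∧ A = P - N ∧ (P.trace + N.trace).re ≤ c

theorem TrLE.isHermitian {A : Matrix ι ι ℂ} {c : ℝ} (h : TrLE A c) : A.IsHermitian := by
  obtain ⟨P, N, hP, hN, rfl, -⟩ := h
  exact hP.isHermitian.sub hN.isHermitian

theorem TrLE.mono {A : Matrix ι ι ℂ} {c c' : ℝ} (h : TrLE A c) (hc : c ≤ c') : TrLE A c' := by
  obtain ⟨P, N, hP, hN, hA, h⟩ := h
  exact ⟨P, N, hP, hN, hA, h.trans hc⟩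

theorem trace_unitary_conj {U : Matrix ι ι ℂ} (hU : U * U.conjTranspose = 1)
    (P : Matrix ι ι ℂ) : (U.conjTranspose * P * U).trace = P.trace := by
  rw [Matrix.trace_mul_comm, ← Matrix.mul_assoc, hU, Matrix.one_mul]

theorem posSemidef_trace_re_nonneg {P : Matrix ι ι ℂ} (hP : P.PosSemidef) : 0 ≤ P.trace.re :=
  (Complex.le_def.1 hP.trace_nonneg).1

/-- In every orthonormal basis the diagonal entries `p` and `q` of the two positive parts satisfy
`|p - q| ≤ p + q`, and `p + q` sums to the total trace. The eigenbasis of `A` gives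
`TrLE.trNorm_le`; the eigenbasis of a different operator is needed for the Powers-Størmer
inequality. -/
theorem TrLE.sum_abs_diag_le {A : Matrix ι ι ℂ} {c : ℝ} (h : TrLE A c) {U : Matrix ι ι ℂ}
    (hU : U * U.conjTranspose = 1) : ∑ i, |((U.conjTranspose * A * U) i i).re| ≤ c := by
  obtain ⟨P, N, hP, hN, rfl, hc⟩ := h
  have hP' := hP.conjTranspose_mul_mul_same U
  have hN' := hN.conjTranspose_mul_mul_same U
  refine le_trans ?_ hc
  rw [← trace_unitary_conj hU P, ← trace_unitary_conj hU N, Complex.add_re]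
  simp only [Matrix.trace, Complex.re_sum, ← Finset.sum_add_distrib]
  refine Finset.sum_le_sum fun i _ => ?_
  have h2 := (Complex.le_def.1 (hP'.diag_nonneg (i := i))).1
  have h3 := (Complex.le_def.1 (hN'.diag_nonneg (i := i))).1
  rw [Matrix.mul_sub, Matrix.sub_mul, Matrix.sub_apply, Complex.sub_re, abs_le]
  simp only [Complex.zero_re, Matrix.diag_apply] at h2 h3 ⊢
  constructor <;> linarith

theorem TrLE.trNorm_le {A : Matrix ι ι ℂ} {c : ℝ} (h : TrLE A c) : trNorm A ≤ c := by
  have hA := h.isHermitian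
  rw [trNorm_eq_sum_abs_eigenvalues hA]
  obtain ⟨U, hU, hU', hd⟩ := exists_unitary_diagonalization hA
  refine le_trans (le_of_eq (Finset.sum_congr rfl fun i _ => ?_)) (h.sum_abs_diag_le hU')
  rw [conj_eq_diagonal hU hd, Matrix.diagonal_apply_eq, Complex.ofReal_re]

/-- Splitting the spectrum into its positive and negative parts attains the smallest possible total
trace. -/
theorem trLE_trNorm {A : Matrix ι ι ℂ} (hA : A.IsHermitian) : TrLE A (trNorm A) := by
  rw [trNorm_eq_sum_abs_eigenvalues hA]
  obtain ⟨U, hU, hU', hd⟩ := exists_unitary_diagonalization hA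
  have key : ∀ f : ι → ℝ, (∀ i, 0 ≤ f i) →
      (U * Matrix.diagonal (fun i => (f i : ℂ)) * U.conjTranspose).PosSemidef ∧
      (U * Matrix.diagonal (fun i => (f i : ℂ)) * U.conjTranspose).trace = ∑ i, (f i : ℂ) := by
    intro f hf
    constructor
    · refine Matrix.PosSemidef.mul_mul_conjTranspose_same
        (Matrix.PosSemidef.diagonal fun i => ?_) U
      simpa using hf i
    · rw [Matrix.trace_mul_comm, ← Matrix.mul_assoc, hU, Matrix.one_mul, Matrix.trace_diagonal]
  obtain ⟨hP, hPt⟩ := key (fun i => max (hA.eigenvalues i) 0) fun i => le_max_right _ _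
  obtain ⟨hN, hNt⟩ := key (fun i => max (-hA.eigenvalues i) 0) fun i => le_max_right _ _
  refine ⟨_, _, hP, hN, ?_, ?_⟩
  · conv_lhs => rw [hd]
    rw [← Matrix.sub_mul, ← Matrix.mul_sub, Matrix.diagonal_sub]
    congr 3
    ext i
    rw [← Complex.ofReal_sub]
    congr 1
    rcases le_total (hA.eigenvalues i) 0 with h | h
    · rw [max_eq_right h, max_eq_left (by linarith)]; ring
    · rw [max_eq_left h, max_eq_right (by linarith)]; ring
  · rw [hPt, hNt, ← Finset.sum_add_distrib, Complex.re_sum]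
    refine (Finset.sum_le_sum fun i _ => ?_)
    rw [← Complex.ofReal_add, Complex.ofReal_re]
    rcases le_total (hA.eigenvalues i) 0 with h | h
    · rw [max_eq_right h, max_eq_left (by linarith), abs_of_nonpos h]; linarith
    · rw [max_eq_left h, max_eq_right (by linarith), abs_of_nonneg h]; linarith

theorem trLE_iff {A : Matrix ι ι ℂ} (hA : A.IsHermitian) {c : ℝ} : TrLE A c ↔ trNorm A ≤ c :=
  ⟨TrLE.trNorm_le, (trLE_trNorm hA).mono⟩

theorem TrLE.add {A B : Matrix ι ι ℂ} {a b : ℝ} (hA : TrLE A a) (hB : TrLE B b) :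
    TrLE (A + B) (a + b) := by
  obtain ⟨P, N, hP, hN, rfl, h⟩ := hA
  obtain ⟨P', N', hP', hN', rfl, h'⟩ := hB
  refine ⟨P + P', N + N', hP.add hP', hN.add hN', by abel, ?_⟩
  simp only [Matrix.trace_add, Complex.add_re] at h h' ⊢
  linarith

theorem TrLE.zero : TrLE (0 : Matrix ι ι ℂ) 0 :=
  ⟨0, 0, Matrix.PosSemidef.zero, Matrix.PosSemidef.zero, by simp, by simp⟩

theorem TrLE.sum {α : Type*} (s : Finset α) {A : α → Matrix ι ι ℂ} {a : α → ℝ}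
    (h : ∀ x ∈ s, TrLE (A x) (a x)) : TrLE (∑ x ∈ s, A x) (∑ x ∈ s, a x) := by
  classical
  induction s using Finset.induction_on with
  | empty => simpa using TrLE.zero
  | insert x s hx ih =>
    rw [Finset.sum_insert hx, Finset.sum_insert hx]
    exact (h x (Finset.mem_insert_self _ _)).add
      (ih fun y hy => h y (Finset.mem_insert_of_mem hy))

theorem posSemidef_smul_real {P : Matrix ι ι ℂ} (hP : P.PosSemidef) {r : ℝ} (hr : 0 ≤ r) :
    ((r : ℂ) • P).PosSemidef :=
  hP.smul (by simpa using hr)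

theorem TrLE.smul {A : Matrix ι ι ℂ} {a : ℝ} (hA : TrLE A a) {r : ℝ} (hr : 0 ≤ r) :
    TrLE ((r : ℂ) • A) (r * a) := by
  obtain ⟨P, N, hP, hN, rfl, h⟩ := hA
  refine ⟨_, _, posSemidef_smul_real hP hr, posSemidef_smul_real hN hr, smul_sub _ _ _, ?_⟩
  rw [Matrix.trace_smul, Matrix.trace_smul, ← smul_add, smul_eq_mul, Complex.re_ofReal_mul]
  exact mul_le_mul_of_nonneg_left h hr

theorem TrLE.sub_of_density {ρ τ : Matrix ι ι ℂ} (hρ : IsDensity ρ) (hτ : IsDensity τ) :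
    TrLE (ρ - τ) 2 :=
  ⟨ρ, τ, hρ.1, hτ.1, rfl, by rw [hρ.2, hτ.2]; norm_num⟩

theorem TrLE.kronecker_left {A : Matrix ι ι ℂ} {a : ℝ} (hA : TrLE A a) {ρ : Matrix κ κ ℂ}
    (hρ : IsDensity ρ) : TrLE (ρ ⊗ₖ A) a := by
  obtain ⟨P, N, hP, hN, rfl, h⟩ := hA
  refine ⟨ρ ⊗ₖ P, ρ ⊗ₖ N, hρ.1.kronecker hP, hρ.1.kronecker hN, ?_, ?_⟩
  · ext ⟨i, j⟩ ⟨i', j'⟩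
    simp [mul_sub]
  · simpa [Matrix.trace_kronecker, hρ.2] using h

theorem TrLE.kronecker_right {A : Matrix ι ι ℂ} {a : ℝ} (hA : TrLE A a) {ρ : Matrix κ κ ℂ}
    (hρ : IsDensity ρ) : TrLE (A ⊗ₖ ρ) a := by
  obtain ⟨P, N, hP, hN, rfl, h⟩ := hA
  refine ⟨P ⊗ₖ ρ, N ⊗ₖ ρ, hP.kronecker hρ.1, hN.kronecker hρ.1, ?_, ?_⟩
  · ext ⟨i, j⟩ ⟨i', j'⟩
    simp [sub_mul]
  · simpa [Matrix.trace_kronecker, hρ.2] using h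

theorem trace_submatrix_equiv (e : κ ≃ ι) (A : Matrix ι ι ℂ) :
    (A.submatrix e e).trace = A.trace := by
  simp only [Matrix.trace, Matrix.diag_apply, Matrix.submatrix_apply]
  exact e.sum_comp fun i => A i i

theorem TrLE.submatrix {A : Matrix ι ι ℂ} {a : ℝ} (hA : TrLE A a) (e : κ ≃ ι) :
    TrLE (A.submatrix e e) a := by
  obtain ⟨P, N, hP, hN, rfl, h⟩ := hA
  refine ⟨_, _, hP.submatrix e, hN.submatrix e, rfl, ?_⟩
  rw [trace_submatrix_equiv, trace_submatrix_equiv]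
  exact h

theorem TrLE.nonneg {A : Matrix ι ι ℂ} {a : ℝ} (hA : TrLE A a) : 0 ≤ a := by
  obtain ⟨P, N, hP, hN, -, h⟩ := hA
  rw [Complex.add_re] at h
  linarith [posSemidef_trace_re_nonneg hP, posSemidef_trace_re_nonneg hN]

theorem trace_conjTranspose_mul_self (A : Matrix ι ι ℂ) :
    (A.conjTranspose * A).trace = ((∑ i, ∑ j, ‖A i j‖ ^ 2 : ℝ) : ℂ) := by
  simp only [Matrix.trace, Matrix.diag_apply, Matrix.mul_apply, Matrix.conjTranspose_apply]
  rw [Finset.sum_comm]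
  push_cast
  refine Finset.sum_congr rfl fun i _ => Finset.sum_congr rfl fun j _ => ?_
  exact Complex.conj_mul' _

/-- The trace norm is at most the square root of the dimension times the Frobenius norm. -/
theorem trNorm_sq_le_card_mul (A : Matrix ι ι ℂ) :
    trNorm A ^ 2 ≤ Fintype.card ι * ∑ i, ∑ j, ‖A i j‖ ^ 2 := by
  have hH := Matrix.isHermitian_conjTranspose_mul_self A
  have h0 : ∀ i, 0 ≤ hH.eigenvalues i :=
    (Matrix.posSemidef_conjTranspose_mul_self A).eigenvalues_nonneg
  have h1 : ∑ i, hH.eigenvalues i = ∑ i, ∑ j, ‖A i j‖ ^ 2 := by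
    have h2 := congrArg Complex.re hH.trace_eq_sum_eigenvalues
    rw [trace_conjTranspose_mul_self, Complex.ofReal_re, Complex.re_sum] at h2
    rw [h2]
    rfl
  rw [← h1]
  have h2 := sq_sum_le_card_mul_sum_sq (s := Finset.univ)
    (f := fun i => Real.sqrt (hH.eigenvalues i))
  simp only [Real.sq_sqrt (h0 _)] at h2
  simpa [trNorm] using h2

end TraceNorm

/-! ### Density operators -/

section Density

variable {ι κ : Type} [Fintype ι] [DecidableEq ι] [Fintype κ] [DecidableEq κ]

theorem IsDensity.isHermitian {ρ : Matrix ι ι ℂ} (h : IsDensity ρ) : ρ.IsHermitian :=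
  h.1.isHermitian

theorem IsDensity.kronecker {ρ : Matrix ι ι ℂ} {σ : Matrix κ κ ℂ} (hρ : IsDensity ρ)
    (hσ : IsDensity σ) : IsDensity (ρ ⊗ₖ σ) :=
  ⟨hρ.1.kronecker hσ.1, by rw [Matrix.trace_kronecker, hρ.2, hσ.2, one_mul]⟩

theorem posSemidef_proj (s : ι) : (proj s).PosSemidef := by
  have : proj s = (proj s).conjTranspose * proj s := by simp [proj]
  rw [this]
  exact Matrix.posSemidef_conjTranspose_mul_self _

theorem isDensity_proj (s : ι) : IsDensity (proj s) := ⟨posSemidef_proj s, by simp [proj]⟩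

theorem IsDensity.sum {α : Type*} [Fintype α] {p : α → ℝ} (hp : ∀ a, 0 ≤ p a)
    (hp1 : ∑ a, p a = 1) {ρ : α → Matrix ι ι ℂ} (hρ : ∀ a, IsDensity (ρ a)) :
    IsDensity (∑ a, (p a : ℂ) • ρ a) := by
  constructor
  · exact Matrix.posSemidef_sum _ fun a _ => posSemidef_smul_real (hρ a).1 (hp a)
  · rw [Matrix.trace_sum]
    simp only [Matrix.trace_smul, (hρ _).2, smul_eq_mul, mul_one]
    rw [← Complex.ofReal_sum, hp1, Complex.ofReal_one]

theorem IsDensity.average {α : Type*} [Fintype α] [Nonempty α] {ρ : α → Matrix ι ι ℂ}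
    (hρ : ∀ a, IsDensity (ρ a)) : IsDensity ((1 / Fintype.card α : ℂ) • ∑ a, ρ a) := by
  have := IsDensity.sum (p := fun _ : α => 1 / (Fintype.card α : ℝ)) (fun _ => by positivity)
    (by simp) hρ
  rw [Finset.smul_sum]
  simpa using this

theorem IsDensity.submatrix {ρ : Matrix ι ι ℂ} (hρ : IsDensity ρ) (e : κ ≃ ι) :
    IsDensity (ρ.submatrix e e) :=
  ⟨hρ.1.submatrix e, by rw [trace_submatrix_equiv]; exact hρ.2⟩

theorem IsCPTP.isDensity {Φ : Matrix ι ι ℂ →ₗ[ℂ] Matrix κ κ ℂ} (hΦ : IsCPTP Φ)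
    {ρ : Matrix ι ι ℂ} (hρ : IsDensity ρ) : IsDensity (Φ ρ) := by
  obtain ⟨r, _, V, hV, hV1⟩ := hΦ
  rw [hV]
  constructor
  · exact Matrix.posSemidef_sum _ fun a _ => hρ.1.mul_mul_conjTranspose_same _
  · rw [Matrix.trace_sum, ← hρ.2]
    conv_rhs => rw [← Matrix.one_mul ρ, ← hV1, Matrix.sum_mul, Matrix.trace_sum]
    refine Finset.sum_congr rfl fun a _ => ?_
    rw [Matrix.trace_mul_comm, ← Matrix.mul_assoc]

end Density

/-! ### Tensor powers -/

section TensorPow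

variable {ι κ : Type} [Fintype ι] [DecidableEq ι] [Fintype κ] [DecidableEq κ] {t : ℕ}

theorem tensorPow_apply (M : Fin t → Matrix ι ι ℂ) (a b : Fin t → ι) :
    tensorPow M a b = ∏ i, M i (a i) (b i) := rfl

theorem tensorPow_mul (M N : Fin t → Matrix ι ι ℂ) :
    tensorPow M * tensorPow N = tensorPow fun i => M i * N i := by
  ext a b
  simp only [Matrix.mul_apply, tensorPow_apply, ← Finset.prod_mul_distrib]
  rw [Finset.prod_univ_sum, Fintype.piFinset_univ]

theorem conjTranspose_tensorPow (M : Fin t → Matrix ι ι ℂ) :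
    (tensorPow M).conjTranspose = tensorPow fun i => (M i).conjTranspose := by
  ext a b
  simp [Matrix.conjTranspose_apply, tensorPow_apply]

theorem trace_tensorPow (M : Fin t → Matrix ι ι ℂ) : (tensorPow M).trace = ∏ i, (M i).trace := by
  simp only [Matrix.trace, Matrix.diag_apply, tensorPow_apply]
  rw [Finset.prod_univ_sum, Fintype.piFinset_univ]

theorem tensorPow_one : tensorPow (fun _ : Fin t => (1 : Matrix ι ι ℂ)) = 1 := by
  ext a b
  simp only [tensorPow_apply, Matrix.one_apply]
  by_cases h : a = b
  · simp [h]
  · rw [if_neg h]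
    obtain ⟨i, hi⟩ := Function.ne_iff.1 h
    exact Finset.prod_eq_zero (Finset.mem_univ i) (if_neg hi)

theorem tensorPow_sum {α : Type*} [Fintype α] (f : Fin t → α → Matrix ι ι ℂ) :
    tensorPow (fun i => ∑ j, f i j) = ∑ x : Fin t → α, tensorPow fun i => f i (x i) := by
  classical
  ext a b
  simp only [Matrix.sum_apply, tensorPow_apply]
  rw [Finset.prod_univ_sum, Fintype.piFinset_univ]

theorem tensorPow_smul (c : ℂ) (M : Fin t → Matrix ι ι ℂ) :
    tensorPow (fun i => c • M i) = c ^ t • tensorPow M := by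
  ext a b
  simp [tensorPow_apply, Finset.prod_mul_distrib]

/-- A factorization turns positivity into an identity that is compatible with tensor products, and
traces of products into Hilbert-Schmidt inner products. -/
theorem exists_conjTranspose_mul_self {P : Matrix ι ι ℂ} (hP : P.PosSemidef) :
    ∃ B : Matrix ι ι ℂ, P = B.conjTranspose * B := by
  obtain ⟨U, hU, hU', hd⟩ := exists_unitary_diagonalization hP.isHermitian
  refine ⟨Matrix.diagonal (fun i => (Real.sqrt (hP.isHermitian.eigenvalues i) : ℂ)) *
    U.conjTranspose, ?_⟩
  conv_lhs => rw [hd]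
  rw [Matrix.conjTranspose_mul, Matrix.conjTranspose_conjTranspose, Matrix.diagonal_conjTranspose]
  have h : ∀ D E : Matrix ι ι ℂ, U * D * (E * U.conjTranspose) = U * (D * E) * U.conjTranspose :=
    fun D E => by simp only [Matrix.mul_assoc]
  rw [h, Matrix.diagonal_mul_diagonal]
  congr 3
  ext i
  simp only [Pi.star_apply, RCLike.star_def, Complex.conj_ofReal]
  rw [← Complex.ofReal_mul, Real.mul_self_sqrt (hP.eigenvalues_nonneg i)]

theorem posSemidef_tensorPow {M : Fin t → Matrix ι ι ℂ} (h : ∀ i, (M i).PosSemidef) :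
    (tensorPow M).PosSemidef := by
  choose B hB using fun i => exists_conjTranspose_mul_self (h i)
  have : tensorPow M = (tensorPow B).conjTranspose * tensorPow B := by
    rw [conjTranspose_tensorPow, tensorPow_mul]
    exact congrArg tensorPow (funext hB)
  rw [this]
  exact Matrix.posSemidef_conjTranspose_mul_self _

theorem IsDensity.tensorPow {M : Fin t → Matrix ι ι ℂ} (h : ∀ i, IsDensity (M i)) :
    IsDensity (tensorPow M) :=
  ⟨posSemidef_tensorPow fun i => (h i).1, by rw [trace_tensorPow]; simp [(h _).2]⟩

theorem tensorPow_update_sub (M : Fin t → Matrix ι ι ℂ) (i : Fin t) (P N : Matrix ι ι ℂ) :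
    tensorPow (Function.update M i (P - N)) =
      tensorPow (Function.update M i P) - tensorPow (Function.update M i N) := by
  ext a b
  have h : ∀ Q : Matrix ι ι ℂ, tensorPow (Function.update M i Q) a b =
      Q (a i) (b i) * ∏ j ∈ Finset.univ.erase i, M j (a j) (b j) := by
    intro Q
    rw [tensorPow_apply, ← Finset.mul_prod_erase _ _ (Finset.mem_univ i), Function.update_self]
    congr 1
    refine Finset.prod_congr rfl fun j hj => ?_
    rw [Function.update_of_ne (Finset.ne_of_mem_erase hj)]
  rw [Matrix.sub_apply, h, h, h, Matrix.sub_apply, sub_mul]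

/-- The other factors are positive of trace one, so tensoring the two parts of the decomposition
with them keeps both positivity and total trace. -/
theorem TrLE.tensorPow_update {M : Fin t → Matrix ι ι ℂ} (hM : ∀ i, IsDensity (M i)) (i : Fin t)
    {A B : Matrix ι ι ℂ} {c : ℝ} (h : TrLE (A - B) c) :
    TrLE (tensorPow (Function.update M i A) - tensorPow (Function.update M i B)) c := by
  rw [← tensorPow_update_sub]
  obtain ⟨P, N, hP, hN, hPN, hc⟩ := h
  rw [hPN]
  have hps : ∀ {Q : Matrix ι ι ℂ}, Q.PosSemidef →
      (tensorPow (Function.update M i Q)).PosSemidef := by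
    intro Q hQ
    refine posSemidef_tensorPow fun j => ?_
    by_cases hj : j = i
    · subst hj; simpa using hQ
    · simpa [Function.update_of_ne hj] using (hM j).1
  have htr : ∀ Q : Matrix ι ι ℂ, (tensorPow (Function.update M i Q)).trace = Q.trace := by
    intro Q
    rw [trace_tensorPow, ← Finset.mul_prod_erase _ _ (Finset.mem_univ i), Function.update_self,
      Finset.prod_eq_one, mul_one]
    intro j hj
    rw [Function.update_of_ne (Finset.ne_of_mem_erase hj), (hM j).2]
  refine ⟨_, _, hps hP, hps hN, tensorPow_update_sub _ _ _ _, ?_⟩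
  rw [htr, htr]
  exact hc

/-- Product states whose factors are `c`-close are `tc`-close. -/
theorem TrLE.tensorPow_sub {A B : Fin t → Matrix ι ι ℂ} (hA : ∀ i, IsDensity (A i))
    (hB : ∀ i, IsDensity (B i)) {c : ℝ} (h : ∀ i, TrLE (A i - B i) c) :
    TrLE (tensorPow A - tensorPow B) (t * c) := by
  -- Hybrid argument: the factors of `B` are exchanged for those of `A` one at a time, each exchange
  -- costing `c`.
  have key : ∀ s : Finset (Fin t), TrLE (tensorPow (s.piecewise A B) - tensorPow B) (s.card * c) := by
    intro s
    induction s using Finset.induction_on with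
    | empty => simpa using TrLE.zero
    | insert i s hi ih =>
      have hM : ∀ j, IsDensity (s.piecewise A B j) := fun j => by
        by_cases hj : j ∈ s <;> simp [hj, hA, hB]
      have h1 := TrLE.tensorPow_update hM i (h i)
      -- Since `i ∉ s`, the hybrid already has `B i` at position `i`, so updating it with `B i`
      -- changes nothing.
      rw [← Finset.piecewise_insert, Function.update_eq_self_iff.2] at h1
      · have h2 := h1.add ih
        rw [sub_add_sub_cancel] at h2
        refine h2.mono (le_of_eq ?_)
        rw [Finset.card_insert_of_notMem hi]
        push_cast
        ring
      · simp [hi]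
  simpa using key Finset.univ

end TensorPow

/-! ### General properties of schemes -/

section Schemes

variable {κ K S C : Type} [Fintype κ] [Fintype K] [DecidableEq K] [Fintype S] [DecidableEq S]
  [Fintype C] [DecidableEq C]

theorem QSR.isDensity_cipher (T : QSR κ K S C) (k : κ) {σ : Matrix S S ℂ} (hσ : IsDensity σ) :
    IsDensity (T.cipher k σ) :=
  T.enc_cptp.isDensity ((T.key_density k).kronecker hσ)

theorem QSR.isDensity_averageCipher (T : QSR κ K S C) {t : ℕ} {σ : Fin t → Matrix S S ℂ}
    (hσ : ∀ i, IsDensity (σ i)) :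
    IsDensity (∑ k, (T.prob k : ℂ) • tensorPow fun i => T.cipher k (σ i)) :=
  IsDensity.sum T.prob_nonneg T.prob_sum fun k =>
    IsDensity.tensorPow fun i => T.isDensity_cipher k (hσ i)

theorem QSR.isDensity_averageCipherKey (T : QSR κ K S C) {t₁ t₂ : ℕ} {σ : Fin t₁ → Matrix S S ℂ}
    (hσ : ∀ i, IsDensity (σ i)) :
    IsDensity (∑ k, (T.prob k : ℂ) • (tensorPow (fun i => T.cipher k (σ i)) ⊗ₖ
      tensorPow (fun _ : Fin t₂ => T.key k))) :=
  IsDensity.sum T.prob_nonneg T.prob_sum fun k =>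
    (IsDensity.tensorPow fun i => T.isDensity_cipher k (hσ i)).kronecker
      (IsDensity.tensorPow fun _ => T.key_density k)

/-- Indistinguishability with all the keys used for encryption is randomization. -/
theorem QSR.Indistinguishable.randomizing {T : QSR κ K S C} {t : ℕ} {ε : ℝ}
    (h : T.Indistinguishable t ε) : T.Randomizing t ε := by
  obtain ⟨τ, hτ, h⟩ := h t 0 (add_zero t)
  let e : (Fin t → C) ≃ (Fin t → C) × (Fin 0 → K) := (Equiv.prodUnique _ _).symm
  refine ⟨τ.submatrix e e, hτ.submatrix e, fun σ hσ => ?_⟩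
  have h1 : TrLE _ ε := (trLE_iff ((T.isDensity_averageCipherKey hσ).isHermitian.sub
    hτ.isHermitian)).2 (h σ hσ)
  have h2 := (h1.submatrix e).trNorm_le
  convert h2 using 2
  rw [Matrix.submatrix_sub]
  congr 1
  ext a b
  simp [Matrix.sum_apply, e, tensorPow_apply]

theorem QSR.Randomizing.mono {T : QSR κ K S C} {t : ℕ} {ε ε' : ℝ} (h : T.Randomizing t ε)
    (hε : ε ≤ ε') : T.Randomizing t ε' := by
  obtain ⟨τ, hτ, h⟩ := h
  exact ⟨τ, hτ, fun σ hσ => (h σ hσ).trans hε⟩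

theorem QSR.Indistinguishable.mono {T : QSR κ K S C} {t : ℕ} {ε ε' : ℝ}
    (h : T.Indistinguishable t ε) (hε : ε ≤ ε') : T.Indistinguishable t ε' := by
  intro t₁ t₂ ht
  obtain ⟨τ, hτ, h⟩ := h t₁ t₂ ht
  exact ⟨τ, hτ, fun σ hσ => (h σ hσ).trans hε⟩

end Schemes

/-! ### Images of random vectors under random matrices -/

section RandomMatrix

theorem sum_comp_eq_card_fiber_nsmul {G H M : Type*} [AddGroup G] [AddGroup H] [Fintype G]
    [Fintype H] [DecidableEq H] [AddCommMonoid M] (φ : G →+ H) (hφ : Function.Surjective φ)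
    (f : H → M) :
    ∑ g, f (φ g) = (Finset.univ.filter fun g => φ g = 0).card • ∑ h, f h := by
  rw [← Finset.sum_fiberwise (s := Finset.univ) (g := φ), Finset.smul_sum]
  refine Finset.sum_congr rfl fun h _ => ?_
  rw [← AddMonoidHom.card_fiber_eq_of_mem_range φ (hφ h) (hφ 0), ← Finset.sum_const]
  refine Finset.sum_congr rfl fun g hg => ?_
  rw [(Finset.mem_filter.1 hg).2]

/-- Averaging over a finite group, pulled back along a surjective homomorphism. -/
theorem card_nsmul_sum_comp_of_surjective {G H M : Type*} [AddGroup G] [AddGroup H] [Fintype G]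
    [Fintype H] [AddCommMonoid M] (φ : G →+ H) (hφ : Function.Surjective φ) (f : H → M) :
    Fintype.card H • ∑ g, f (φ g) = Fintype.card G • ∑ h, f h := by
  classical
  -- The constant function gives `|G| = |ker φ| * |H|`.
  have h1 := sum_comp_eq_card_fiber_nsmul φ hφ (fun _ => 1)
  simp only [Finset.sum_const, Finset.card_univ, smul_eq_mul, mul_one] at h1
  rw [sum_comp_eq_card_fiber_nsmul φ hφ, smul_smul, h1, mul_comm]

variable {m n : ℕ} {κ : Type} [Fintype κ] [DecidableEq κ]

/-- The linear map `A ↦ (A xᵢ)ᵢ`. -/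
def mulVecHom (m : ℕ) (x : κ → Bits n) : Matrix (Fin m) (Fin n) (ZMod 2) →+ (κ → Bits m) where
  toFun A i := A.mulVec (x i)
  map_zero' := by ext; simp
  map_add' A B := by ext; simp [Matrix.add_mulVec]

/-- An independent family extends to a basis, and a linear map may take arbitrary values on a basis.
Surjectivity is what makes the images under a uniform matrix jointly uniform. -/
theorem mulVecHom_surjective {x : κ → Bits n} (hx : LinearIndependent (ZMod 2) x) :
    Function.Surjective (mulVecHom m x) := by
  intro y
  let b := Module.Basis.extend hx.linearIndepOn_id
  have hb : ∀ i, ∃ f : Bits n →ₗ[ZMod 2] Bits m, ∀ j, f (x j) = if j = i then y i else 0 := by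
    intro i
    have hmem : ∀ j, x j ∈ hx.linearIndepOn_id.extend (Set.subset_univ _) := fun j =>
      hx.linearIndepOn_id.subset_extend _ ⟨j, rfl⟩
    refine ⟨b.constr (ZMod 2) fun v => if (v : Bits n) = x i then y i else 0, fun j => ?_⟩
    have h1 : x j = b ⟨x j, hmem j⟩ := by simp [b]
    rw [h1, Module.Basis.constr_basis]
    simp [hx.injective.eq_iff]
  choose f hf using hb
  refine ⟨LinearMap.toMatrix' (∑ i, f i), ?_⟩
  ext j k
  change (LinearMap.toMatrix' (∑ i, f i)).mulVec (x j) k = y j k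
  rw [LinearMap.toMatrix'_mulVec]
  simp [hf, ite_apply]

/-- Few families of vectors are linearly dependent. -/
theorem card_not_linearIndependent_le :
    Nat.card {x : κ → Bits n // ¬ LinearIndependent (ZMod 2) x} * 2 ^ n ≤
      2 ^ Fintype.card κ * Fintype.card (κ → Bits n) := by
  classical
  -- For a fixed nonzero `c` the combination `∑ cᵢ xᵢ` is a surjective homomorphism in `x`, so it
  -- vanishes on exactly a fraction `2⁻ⁿ` of the families.
  have hfib : ∀ c : κ → ZMod 2, c ≠ 0 →
      (Finset.univ.filter fun x : κ → Bits n => ∑ i, c i • x i = 0).card * 2 ^ n =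
        Fintype.card (κ → Bits n) := by
    intro c hc
    let φ : (κ → Bits n) →+ Bits n :=
      { toFun := fun x => ∑ i, c i • x i
        map_zero' := by simp
        map_add' := fun x y => by simp [smul_add, Finset.sum_add_distrib] }
    have hφ : Function.Surjective φ := by
      obtain ⟨i, hi⟩ := Function.ne_iff.1 hc
      intro v
      refine ⟨Pi.single i ((c i)⁻¹ • v), ?_⟩
      change ∑ j, c j • (Pi.single i ((c i)⁻¹ • v) : κ → Bits n) j = v
      rw [Finset.sum_eq_single i]
      · rw [Pi.single_eq_same, smul_smul, mul_inv_cancel₀ hi, one_smul]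
      · intro j _ hj
        rw [Pi.single_eq_of_ne hj, smul_zero]
      · simp
    have h := card_nsmul_sum_comp_of_surjective φ hφ fun v => if v = 0 then 1 else 0
    simp only [Finset.sum_ite_eq', Finset.mem_univ, if_true, smul_eq_mul, mul_one,
      Finset.sum_boole, Nat.cast_id] at h
    rw [mul_comm, ← h]
    simp [ZMod.card, φ]
  -- Union bound over the nonzero coefficient vectors; the zero vector is added back at the end to
  -- get the round count `2 ^ |κ|`.
  have hsub : (Finset.univ.filter fun x : κ → Bits n => ¬ LinearIndependent (ZMod 2) x) ⊆
      (Finset.univ.filter fun c : κ → ZMod 2 => c ≠ 0).biUnion fun c =>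
        Finset.univ.filter fun x : κ → Bits n => ∑ i, c i • x i = 0 := by
    intro x hx
    rw [Finset.mem_filter, Fintype.not_linearIndependent_iff] at hx
    obtain ⟨-, c, hc, i, hi⟩ := hx
    simp only [Finset.mem_biUnion, Finset.mem_filter, Finset.mem_univ, true_and]
    exact ⟨c, fun h => hi (by simp [h]), hc⟩
  rw [Nat.card_eq_fintype_card, Fintype.card_subtype]
  calc _ ≤ (∑ c ∈ Finset.univ.filter fun c : κ → ZMod 2 => c ≠ 0,
        (Finset.univ.filter fun x : κ → Bits n => ∑ i, c i • x i = 0).card) * 2 ^ n :=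
        Nat.mul_le_mul_right _ ((Finset.card_le_card hsub).trans Finset.card_biUnion_le)
    _ = ∑ c ∈ Finset.univ.filter fun c : κ → ZMod 2 => c ≠ 0, Fintype.card (κ → Bits n) := by
        rw [Finset.sum_mul]
        exact Finset.sum_congr rfl fun c hc => hfib c (Finset.mem_filter.1 hc).2
    _ ≤ ∑ c : κ → ZMod 2, Fintype.card (κ → Bits n) :=
        Finset.sum_le_sum_of_subset (Finset.filter_subset _ _)
    _ = _ := by simp [ZMod.card]

variable {ι : Type} [Fintype ι] [DecidableEq ι]

/-- Replacing the images `A xᵢ` of independent uniform vectors under a uniform matrix by independent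
uniform vectors changes an average of density operators by at most `2 ^ (t - n + 1)`. -/
theorem trLE_average_mulVec_sub (Z : (κ → Bits m) → (κ → Bits n) → Matrix ι ι ℂ)
    (hZ : ∀ y x, IsDensity (Z y x)) :
    TrLE ((1 / Fintype.card (κ → Bits n) : ℂ) • ∑ x : κ → Bits n,
        (1 / Fintype.card (Matrix (Fin m) (Fin n) (ZMod 2)) : ℂ) •
          ∑ A : Matrix (Fin m) (Fin n) (ZMod 2), Z (fun i => A.mulVec (x i)) x -
      (1 / Fintype.card (κ → Bits n) : ℂ) • ∑ x : κ → Bits n,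
        (1 / Fintype.card (κ → Bits m) : ℂ) • ∑ y : κ → Bits m, Z y x)
      ((2 : ℝ) ^ ((Fintype.card κ : ℝ) - n + 1)) := by
  classical
  rw [← smul_sub, ← Finset.sum_sub_distrib]
  -- For independent `x` the two averages coincide. For dependent `x` the trivial distance `2` of
  -- two states is used, so the total error is twice the probability of dependence.
  have hgood : ∀ x : κ → Bits n, TrLE
      ((1 / Fintype.card (Matrix (Fin m) (Fin n) (ZMod 2)) : ℂ) •
          ∑ A : Matrix (Fin m) (Fin n) (ZMod 2), Z (fun i => A.mulVec (x i)) x -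
        (1 / Fintype.card (κ → Bits m) : ℂ) • ∑ y : κ → Bits m, Z y x)
      (if LinearIndependent (ZMod 2) x then 0 else 2) := by
    intro x
    split_ifs with hx
    · have h := card_nsmul_sum_comp_of_surjective (mulVecHom m x) (mulVecHom_surjective hx)
        fun y => Z y x
      have h1 : ((Fintype.card (κ → Bits m) : ℕ) : ℂ) ≠ 0 :=
        Nat.cast_ne_zero.2 Fintype.card_ne_zero
      have h2 : ((Fintype.card (Matrix (Fin m) (Fin n) (ZMod 2)) : ℕ) : ℂ) ≠ 0 :=
        Nat.cast_ne_zero.2 Fintype.card_ne_zero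
      rw [← Nat.cast_smul_eq_nsmul ℂ, ← Nat.cast_smul_eq_nsmul ℂ] at h
      have h3 : (1 / Fintype.card (Matrix (Fin m) (Fin n) (ZMod 2)) : ℂ) •
          ∑ A : Matrix (Fin m) (Fin n) (ZMod 2), Z (fun i => A.mulVec (x i)) x =
          (1 / Fintype.card (κ → Bits m) : ℂ) • ∑ y : κ → Bits m, Z y x := by
        rw [one_div, one_div, inv_smul_eq_iff₀ h2, smul_comm, ← h, inv_smul_smul₀ h1]
        rfl
      rw [h3, sub_self]
      exact TrLE.zero
    · exact TrLE.sub_of_density (IsDensity.average fun A => hZ _ _)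
        (IsDensity.average fun y => hZ _ _)
  have h := (TrLE.sum Finset.univ fun x _ => hgood x).smul
    (r := 1 / Fintype.card (κ → Bits n)) (by positivity)
  have hcast : ((1 / Fintype.card (κ → Bits n) : ℝ) : ℂ) = (1 / Fintype.card (κ → Bits n) : ℂ) := by
    push_cast
    rfl
  rw [hcast] at h
  refine h.mono ?_
  have hsum : ∑ x : κ → Bits n, (if LinearIndependent (ZMod 2) x then (0 : ℝ) else 2) =
      Nat.card {x : κ → Bits n // ¬ LinearIndependent (ZMod 2) x} * 2 := by
    rw [Nat.card_eq_fintype_card, Fintype.card_subtype, Finset.card_filter]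
    push_cast
    rw [Finset.sum_mul]
    refine Finset.sum_congr rfl fun x _ => ?_
    split_ifs <;> simp
  have hle : (Nat.card {x : κ → Bits n // ¬ LinearIndependent (ZMod 2) x} : ℝ) * 2 ^ n ≤
      2 ^ Fintype.card κ * Fintype.card (κ → Bits n) := by
    exact_mod_cast card_not_linearIndependent_le (n := n) (κ := κ)
  have hpos : (0 : ℝ) < Fintype.card (κ → Bits n) := Nat.cast_pos.2 Fintype.card_pos
  rw [hsum, Real.rpow_add two_pos, Real.rpow_sub two_pos, Real.rpow_natCast, Real.rpow_natCast,
    Real.rpow_one, one_div, inv_mul_le_iff₀ hpos, ← mul_assoc]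
  refine mul_le_mul_of_nonneg_right ?_ two_pos.le
  rw [← mul_div_assoc, le_div_iff₀ (by positivity)]
  linarith

end RandomMatrix

/-! ### Decoding conditioned on a classical register -/

section Block

variable {C D R : Type} [Fintype C] [DecidableEq C] [Fintype D] [DecidableEq D] [Fintype R]
  [DecidableEq R]

/-- Measure the register `C` and, on the outcome `c`, apply `L c`. -/
noncomputable def blockMap (L : C → Matrix D D ℂ →ₗ[ℂ] Matrix R R ℂ) :
    Matrix (C × D) (C × D) ℂ →ₗ[ℂ] Matrix R R ℂ where
  toFun X := ∑ c, L c (X.submatrix (Prod.mk c) (Prod.mk c))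
  map_add' X Y := by simp [Matrix.submatrix_add, Finset.sum_add_distrib]
  map_smul' z X := by simp [Matrix.submatrix_smul, Finset.smul_sum]

theorem blockMap_proj_kronecker (L : C → Matrix D D ℂ →ₗ[ℂ] Matrix R R ℂ) (c : C)
    (Y : Matrix D D ℂ) : blockMap L (proj c ⊗ₖ Y) = L c Y := by
  change ∑ c', L c' ((proj c ⊗ₖ Y).submatrix (Prod.mk c') (Prod.mk c')) = _
  rw [Finset.sum_eq_single c]
  · congr 1
    ext i j
    simp [proj]
  · intro c' _ hc
    have : (proj c ⊗ₖ Y).submatrix (Prod.mk c') (Prod.mk c') = 0 := by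
      ext i j
      simp [proj, hc.symm]
    rw [this, map_zero]
  · simp

theorem isCPTP_blockMap {L : C → Matrix D D ℂ →ₗ[ℂ] Matrix R R ℂ} (hL : ∀ c, IsCPTP (L c)) :
    IsCPTP (blockMap L) := by
  choose r hr W hW hW1 using hL
  -- `B c` is `⟨c| ⊗ 1`; composing it with the Kraus operators of `L c` gives those of the whole
  -- map.
  let B : C → Matrix D (C × D) ℂ := fun c => Matrix.of fun d p => if (c, d) = p then 1 else 0
  have hB : ∀ (c : C) (X : Matrix (C × D) (C × D) ℂ), B c * X * (B c).conjTranspose = X.submatrix (Prod.mk c) (Prod.mk c) := by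
    intro c X
    ext i j
    simp [B, Matrix.mul_apply, Matrix.conjTranspose_apply, apply_ite]
  have hBB : ∑ c, (B c).conjTranspose * B c = 1 := by
    ext ⟨a, c⟩ ⟨b, e⟩
    simp only [B, Matrix.sum_apply, Matrix.mul_apply, Matrix.conjTranspose_apply, Matrix.of_apply,
      Matrix.one_apply, Prod.mk.injEq]
    by_cases hab : a = b <;> by_cases hce : c = e <;> simp [hab, hce, ite_and]
    all_goals grind
  refine ⟨(c : C) × r c, inferInstance, fun x => W x.1 x.2 * B x.1, fun X => ?_, ?_⟩
  · rw [Fintype.sum_sigma]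
    change ∑ c, L c (X.submatrix (Prod.mk c) (Prod.mk c)) = _
    refine Finset.sum_congr rfl fun c _ => ?_
    rw [hW, ← hB]
    simp only [Matrix.conjTranspose_mul, Matrix.mul_assoc]
  · rw [Fintype.sum_sigma, ← hBB]
    refine Finset.sum_congr rfl fun c _ => ?_
    calc ∑ a, (W c a * B c).conjTranspose * (W c a * B c)
        = (B c).conjTranspose * (∑ a, (W c a).conjTranspose * W c a) * B c := by
          simp only [Matrix.conjTranspose_mul, Matrix.mul_sum, Matrix.sum_mul, Matrix.mul_assoc]
      _ = _ := by rw [hW1, Matrix.mul_one]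

end Block

theorem kronecker_sub {ι κ : Type} (A : Matrix ι ι ℂ) (B B' : Matrix κ κ ℂ) :
    A ⊗ₖ (B - B') = A ⊗ₖ B - A ⊗ₖ B' := by
  ext ⟨i, j⟩ ⟨i', j'⟩
  simp [mul_sub]

theorem sub_kronecker {ι κ : Type} (A A' : Matrix ι ι ℂ) (B : Matrix κ κ ℂ) :
    (A - A') ⊗ₖ B = A ⊗ₖ B - A' ⊗ₖ B := by
  ext ⟨i, j⟩ ⟨i', j'⟩
  simp [sub_mul]

theorem smul_sum_kronecker {α ι κ : Type} [Fintype α] (c : ℂ) (f : α → Matrix ι ι ℂ)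
    (B : Matrix κ κ ℂ) : (c • ∑ a, f a) ⊗ₖ B = c • ∑ a, f a ⊗ₖ B := by
  ext ⟨i, j⟩ ⟨i', j'⟩
  simp [Matrix.sum_apply, Finset.sum_mul, mul_assoc]

/-! ### The combined scheme -/

section Combined

variable {m n : ℕ}

theorem shiftU_apply (i j : (Bits m × Bits n) × Bits m) :
    shiftU m n i j = if i = ((j.1.1 + j.2, j.1.2), j.2) then 1 else 0 := by
  obtain ⟨⟨y', x'⟩, s'⟩ := i
  obtain ⟨⟨y, x⟩, s⟩ := j
  simp only [shiftU, Matrix.sum_apply, Matrix.kroneckerMap_apply, Matrix.single_apply,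
    Prod.mk.injEq]
  rw [Finset.sum_eq_single x, Finset.sum_eq_single s, Finset.sum_eq_single y]
  · by_cases h1 : y' = y + s <;> by_cases h2 : x' = x <;> by_cases h3 : s' = s <;>
      simp [h1, h2, h3, eq_comm]
  · intro b _ hb; simp [hb]
  · simp
  · intro b _ hb; simp [hb]
  · simp
  · intro b _ hb; simp [hb]
  · simp

theorem shiftEnc_proj (y : Bits m) (x : Bits n) (s : Bits m) :
    shiftEnc m n (proj (y, x) ⊗ₖ proj s) = proj (y + s, x) := by
  have h1 : proj (y, x) ⊗ₖ proj s = proj ((y, x), s) := by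
    simp [proj, Matrix.single_kronecker_single]
  have h2 : ∀ a b, (shiftU m n * proj ((y, x), s) * (shiftU m n).conjTranspose) a b =
      shiftU m n a ((y, x), s) * star (shiftU m n b ((y, x), s)) := by
    intro a b
    rw [Matrix.mul_apply, Finset.sum_eq_single ((y, x), s)]
    · rw [Matrix.mul_apply, Finset.sum_eq_single ((y, x), s)]
      · simp [proj, Matrix.conjTranspose_apply]
      · intro c _ hc
        simp [proj, hc.symm]
      · simp
    · intro c _ hc
      rw [Matrix.mul_apply, Finset.sum_eq_zero, zero_mul]
      intro d _
      simp [proj, hc.symm]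
    · simp
  rw [h1]
  ext a b
  change ∑ c, (shiftU m n * proj ((y, x), s) * (shiftU m n).conjTranspose) (a, c) (b, c) = _
  rw [Finset.sum_congr rfl fun c _ => h2 _ _]
  simp only [shiftU_apply, proj, Matrix.single_apply, Prod.mk.injEq]
  rw [Finset.sum_eq_single s]
  · by_cases ha : a = (y + s, x) <;> by_cases hb : b = (y + s, x) <;> simp [ha, hb, eq_comm]
  · intro c _ hc
    simp [hc]
  · simp

theorem linKey_eq_average (A : Matrix (Fin m) (Fin n) (ZMod 2)) :
    linKey m n A = (1 / Fintype.card (Bits n) : ℂ) • ∑ x : Bits n, proj (A.mulVec x, x) := by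
  simp [linKey, ZMod.card]

variable {R D : Type} [Fintype R] [DecidableEq R] [Fintype D] [DecidableEq D]
  (P : ClassicalKeyQSR (Bits m) R D)

/-- The cipher for the key element `|y, x⟩⟨y, x|` in the combined scheme. -/
noncomputable def maskedCipher (y : Bits m) (x : Bits n) (σ : Matrix R R ℂ) :
    Matrix ((Bits m × Bits n) × D) ((Bits m × Bits n) × D) ℂ :=
  ∑ s, (P.prob s : ℂ) • (proj (y + s, x) ⊗ₖ P.enc s σ)

theorem isDensity_maskedCipher (y : Bits m) (x : Bits n) {σ : Matrix R R ℂ} (hσ : IsDensity σ) :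
    IsDensity (maskedCipher P y x σ) :=
  IsDensity.sum P.prob_nonneg P.prob_sum fun s =>
    (isDensity_proj _).kronecker ((P.enc_cptp s).isDensity hσ)

/-- By linearity the matrix `A` enters only through the mask `y = A x`, which is the quantity that
the random matrix bound later replaces by a uniform string. -/
theorem combine_cipher (A : Matrix (Fin m) (Fin n) (ZMod 2)) (σ : Matrix R R ℂ) :
    (combine (linScheme m n) P).cipher A σ =
      (1 / Fintype.card (Bits n) : ℂ) • ∑ x, maskedCipher P (A.mulVec x) x σ := by
  change combineEnc (linScheme m n) P (linKey m n A ⊗ₖ σ) = _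
  rw [combineEnc_kronecker, linKey_eq_average]
  simp only [maskedCipher]
  conv_rhs => rw [Finset.sum_comm, Finset.smul_sum]
  refine Finset.sum_congr rfl fun s _ => ?_
  change (P.prob s : ℂ) • (shiftEnc m n _ ⊗ₖ _) = _
  rw [smul_sum_kronecker, map_smul, map_sum, smul_sum_kronecker, smul_comm, Finset.smul_sum]
  simp only [shiftEnc_proj]

theorem combine_invertible (hP : P.Invertible) : (combine (linScheme m n) P).Invertible := by
  intro A _
  obtain ⟨s₀, hs₀⟩ : ∃ s, 0 < P.prob s := by
    by_contra! h
    have := Finset.sum_nonpos fun s (_ : s ∈ Finset.univ) => h s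
    rw [P.prob_sum] at this
    linarith
  -- Invertibility gives no decoder for `s` of probability zero. The decoder of some `s₀` of
  -- positive probability is put there, since a measurement outcome must always be followed by a
  -- CPTP map.
  have hDec : ∀ s, ∃ Dec : Matrix D D ℂ →ₗ[ℂ] Matrix R R ℂ, IsCPTP Dec ∧
      (0 < P.prob s → ∀ σ, IsDensity σ → Dec (P.enc s σ) = σ) := by
    intro s
    by_cases hs : 0 < P.prob s
    · obtain ⟨Dec, h1, h2⟩ := hP s hs
      exact ⟨Dec, h1, fun _ => h2⟩
    · obtain ⟨Dec, h1, -⟩ := hP s₀ hs₀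
      exact ⟨Dec, h1, fun h => absurd h hs⟩
  choose Dec hDec1 hDec2 using hDec
  -- The measured register holds `(A x + s, x)`, so subtracting `A x` recovers `s`.
  refine ⟨blockMap fun c : Bits m × Bits n => Dec (c.1 - A.mulVec c.2),
    isCPTP_blockMap fun c => hDec1 _, fun σ hσ => ?_⟩
  rw [combine_cipher, map_smul, map_sum]
  have h : ∀ x : Bits n, blockMap (fun c : Bits m × Bits n => Dec (c.1 - A.mulVec c.2))
      (maskedCipher P (A.mulVec x) x σ) = σ := by
    intro x
    rw [maskedCipher, map_sum]
    have h1 : ∀ s, blockMap (fun c : Bits m × Bits n => Dec (c.1 - A.mulVec c.2))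
        ((P.prob s : ℂ) • (proj (A.mulVec x + s, x) ⊗ₖ P.enc s σ)) = (P.prob s : ℂ) • σ := by
      intro s
      rw [map_smul, blockMap_proj_kronecker, add_sub_cancel_left]
      rcases (P.prob_nonneg s).eq_or_lt with h0 | h0
      · rw [← h0]; simp
      · rw [hDec2 s h0 σ hσ]
    rw [Finset.sum_congr rfl fun s _ => h1 s, ← Finset.sum_smul, ← Complex.ofReal_sum, P.prob_sum,
      Complex.ofReal_one, one_smul]
  rw [Finset.sum_congr rfl fun x _ => h x, Finset.sum_const, Finset.card_univ,
    ← Nat.cast_smul_eq_nsmul ℂ, smul_smul, one_div, inv_mul_cancel₀, one_smul]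
  exact Nat.cast_ne_zero.2 Fintype.card_ne_zero

theorem combine_classicalKeys : (combine (linScheme m n) P).ClassicalKeys := by
  intro A i j hij
  change linKey m n A i j = 0
  rw [linKey, Matrix.smul_apply, Matrix.sum_apply, Finset.sum_eq_zero, smul_zero]
  intro x _
  rw [proj, Matrix.single_apply, if_neg]
  rintro ⟨rfl, rfl⟩
  exact hij rfl

theorem combine_keyEntropy : (combine (linScheme m n) P).keyEntropy = n * m := by
  have hc : Fintype.card (Matrix (Fin m) (Fin n) (ZMod 2)) = 2 ^ (n * m) := by
    rw [Fintype.card_congr (Matrix.of (m := Fin m) (n := Fin n) (α := ZMod 2)).symm,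
      Fintype.card_fun, Fintype.card_fun, ZMod.card, Fintype.card_fin, Fintype.card_fin, pow_mul]
  change entropy (fun _ => 1 / (Fintype.card (Matrix (Fin m) (Fin n) (ZMod 2)) : ℝ)) = _
  rw [entropy, Finset.sum_const, Finset.card_univ, hc, nsmul_eq_mul, ← mul_assoc]
  push_cast
  rw [mul_one_div_cancel (by positivity), one_mul, one_div_one_div, Real.logb_pow,
    Real.logb_self_eq_one one_lt_two]
  push_cast
  ring

/-- Independent uniform indices in the tensor factors: the average of the product is the product of
the averages. The two groups of factors are the used and the unused key copies. -/
theorem average_tensorPow_kronecker {ι κ α : Type} [Fintype ι] [DecidableEq ι] [Fintype κ]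
    [DecidableEq κ] [Fintype α] {t₁ t₂ : ℕ} (f : Fin t₁ → α → Matrix ι ι ℂ)
    (g : Fin t₂ → α → Matrix κ κ ℂ) :
    (1 / Fintype.card (Fin t₁ ⊕ Fin t₂ → α) : ℂ) • ∑ x : Fin t₁ ⊕ Fin t₂ → α,
      (tensorPow fun i => f i (x (Sum.inl i))) ⊗ₖ (tensorPow fun j => g j (x (Sum.inr j))) =
    tensorPow (fun i => (1 / Fintype.card α : ℂ) • ∑ a, f i a) ⊗ₖ
      tensorPow (fun j => (1 / Fintype.card α : ℂ) • ∑ a, g j a) := by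
  rw [tensorPow_smul, tensorPow_smul, tensorPow_sum, tensorPow_sum,
    ← (Equiv.sumArrowEquivProdArrow (Fin t₁) (Fin t₂) α).symm.sum_comp, Fintype.sum_prod_type]
  ext ⟨a, b⟩ ⟨a', b'⟩
  simp only [Matrix.smul_apply, Matrix.sum_apply, Matrix.kroneckerMap_apply, smul_eq_mul,
    Equiv.sumArrowEquivProdArrow, Equiv.coe_fn_symm_mk, Sum.elim_inl, Sum.elim_inr]
  rw [mul_mul_mul_comm, ← pow_add, Finset.sum_mul_sum]
  congr 1
  simp

set_option synthInstance.maxSize 1000 in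
set_option synthInstance.maxHeartbeats 200000 in
-- Two hybrids: first every mask `A xᵢ` becomes a fresh uniform `yᵢ`, over used and unused key
-- copies alike, at cost `ε₁`; then each of the `t₁` pad ciphers is replaced by `τ` at cost `ε₂`.
theorem combine_indistinguishable {d : ℕ} (P : ClassicalKeyQSR (Bits m) (Fin d) D) (hd : 0 < d)
    {t : ℕ} {ε₁ ε₂ : ℝ} (hε₁ : ε₁ = (2 : ℝ) ^ ((t : ℝ) - n + 1)) (hP : P.Randomizing ε₂) :
    (combine (linScheme m n) P).Indistinguishable t (ε₁ + t * ε₂) := by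
  intro t₁ t₂ ht
  obtain ⟨τ, hτ, hP⟩ := hP
  have havg : ∀ {σ : Matrix (Fin d) (Fin d) ℂ}, IsDensity σ →
      IsDensity (∑ s, (P.prob s : ℂ) • P.enc s σ) := fun hσ =>
    IsDensity.sum P.prob_nonneg P.prob_sum fun s => (P.enc_cptp s).isDensity hσ
  have hP' : ∀ {σ : Matrix (Fin d) (Fin d) ℂ}, IsDensity σ →
      TrLE (∑ s, (P.prob s : ℂ) • P.enc s σ - τ) ε₂ := fun hσ =>
    (trLE_iff ((havg hσ).isHermitian.sub hτ.isHermitian)).2 (hP _ hσ)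
  -- This needs a density operator to exist, hence `0 < d`. It allows `t₁ * ε₂` to be bounded by `t
  -- * ε₂`.
  have hε₂ : 0 ≤ ε₂ := (hP' (isDensity_proj (⟨0, hd⟩ : Fin d))).nonneg
  let u : Matrix (Bits m × Bits n) (Bits m × Bits n) ℂ :=
    (1 / Fintype.card (Bits n) : ℂ) • ∑ x : Bits n,
      (1 / Fintype.card (Bits m) : ℂ) • ∑ y : Bits m, proj (y, x)
  have hu : IsDensity u := IsDensity.average fun x => IsDensity.average fun y => isDensity_proj _
  refine ⟨tensorPow (fun _ => u ⊗ₖ τ) ⊗ₖ tensorPow (fun _ => u),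
    (IsDensity.tensorPow fun _ => hu.kronecker hτ).kronecker (IsDensity.tensorPow fun _ => hu),
    fun σ hσ => TrLE.trNorm_le ?_⟩
  -- The adversary's state for given masks `y` and seeds `x`; the real state has `yᵢ = A xᵢ`.
  let Z : (Fin t₁ ⊕ Fin t₂ → Bits m) → (Fin t₁ ⊕ Fin t₂ → Bits n) → Matrix _ _ ℂ := fun y x =>
    (tensorPow fun i => maskedCipher P (y (Sum.inl i)) (x (Sum.inl i)) (σ i)) ⊗ₖ
      (tensorPow fun j => proj (y (Sum.inr j), x (Sum.inr j)))
  have hZ : ∀ y x, IsDensity (Z y x) := fun y x =>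
    (IsDensity.tensorPow fun i => isDensity_maskedCipher P _ _ (hσ i)).kronecker
      (IsDensity.tensorPow fun j => isDensity_proj _)
  have h1 := trLE_average_mulVec_sub Z hZ
  have hstate : (1 / Fintype.card (Fin t₁ ⊕ Fin t₂ → Bits n) : ℂ) •
      ∑ x : Fin t₁ ⊕ Fin t₂ → Bits n, (1 / Fintype.card (Matrix (Fin m) (Fin n) (ZMod 2)) : ℂ) •
          ∑ A : Matrix (Fin m) (Fin n) (ZMod 2), Z (fun i => A.mulVec (x i)) x =
      ∑ A, ((combine (linScheme m n) P).prob A : ℂ) •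
        (tensorPow (fun i => (combine (linScheme m n) P).cipher A (σ i)) ⊗ₖ
          tensorPow (fun _ : Fin t₂ => (combine (linScheme m n) P).key A)) := by
    rw [← Finset.smul_sum, Finset.sum_comm, smul_comm, Finset.smul_sum, Finset.smul_sum]
    refine Finset.sum_congr rfl fun A _ => ?_
    have h2 := average_tensorPow_kronecker (t₂ := t₂)
      (fun i x => maskedCipher P (A.mulVec x) x (σ i)) (fun _ x => proj (A.mulVec x, x))
    rw [h2]
    simp only [← combine_cipher, ← linKey_eq_average]
    congr 1
    change _ = (((1 / (Fintype.card (Matrix (Fin m) (Fin n) (ZMod 2)) : ℝ)) : ℝ) : ℂ)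
    push_cast
    rfl
  -- With fresh masks the state is a product: a maximally mixed key register at each position,
  -- tensored with the pad cipher under an unknown key at the used positions.
  have hmid : (1 / Fintype.card (Fin t₁ ⊕ Fin t₂ → Bits n) : ℂ) •
      ∑ x : Fin t₁ ⊕ Fin t₂ → Bits n, (1 / Fintype.card (Fin t₁ ⊕ Fin t₂ → Bits m) : ℂ) •
          ∑ y : Fin t₁ ⊕ Fin t₂ → Bits m, Z y x =
      tensorPow (fun i => u ⊗ₖ ∑ s, (P.prob s : ℂ) • P.enc s (σ i)) ⊗ₖ
        tensorPow (fun _ : Fin t₂ => u) := by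
    have h2 : ∀ x : Fin t₁ ⊕ Fin t₂ → Bits n, (1 / Fintype.card (Fin t₁ ⊕ Fin t₂ → Bits m) : ℂ) •
        ∑ y : Fin t₁ ⊕ Fin t₂ → Bits m, Z y x = _ := fun x =>
      average_tensorPow_kronecker (fun i y => maskedCipher P y (x (Sum.inl i)) (σ i))
        (fun j y => proj (y, x (Sum.inr j)))
    simp only [h2]
    have h3 := average_tensorPow_kronecker (t₂ := t₂) (fun i x =>
      (1 / Fintype.card (Bits m) : ℂ) • ∑ y : Bits m, maskedCipher P y x (σ i))
      (fun _ (x : Bits n) => (1 / Fintype.card (Bits m) : ℂ) • ∑ y : Bits m, proj (y, x))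
    rw [h3]
    congr 2
    funext i
    rw [smul_sum_kronecker]
    congr 1
    refine Finset.sum_congr rfl fun x _ => ?_
    rw [smul_sum_kronecker]
    congr 1
    simp only [maskedCipher]
    rw [Finset.sum_comm]
    -- Translation by `s` permutes the uniform `y`, so the register carries no information about the
    -- pad key.
    have h4 : ∀ s : Bits m, ∑ y : Bits m, (P.prob s : ℂ) • (proj (y + s, x) ⊗ₖ P.enc s (σ i)) =
        ∑ y : Bits m, (P.prob s : ℂ) • (proj (y, x) ⊗ₖ P.enc s (σ i)) := fun s =>
      Equiv.sum_comp (Equiv.addRight s) fun y => (P.prob s : ℂ) • (proj (y, x) ⊗ₖ P.enc s (σ i))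
    rw [Finset.sum_congr rfl fun s _ => h4 s, Finset.sum_comm]
    refine Finset.sum_congr rfl fun y _ => ?_
    ext ⟨a, b⟩ ⟨a', b'⟩
    simp only [Matrix.sum_apply, Matrix.smul_apply, Matrix.kroneckerMap_apply, smul_eq_mul,
      Finset.mul_sum]
    exact Finset.sum_congr rfl fun s _ => by ring
  rw [hstate, hmid] at h1
  have h2 := (TrLE.tensorPow_sub (fun i => hu.kronecker (havg (hσ i)))
    (fun _ => hu.kronecker hτ) (c := ε₂) fun i => by
      have := (hP' (hσ i)).kronecker_left hu
      rwa [kronecker_sub] at this).kronecker_right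
      (IsDensity.tensorPow fun _ : Fin t₂ => hu)
  rw [sub_kronecker] at h2
  have h3 := h1.add h2
  rw [sub_add_sub_cancel] at h3
  refine h3.mono (add_le_add (le_of_eq ?_) (mul_le_mul_of_nonneg_right ?_ hε₂))
  · rw [hε₁, ← ht]
    simp
  · exact_mod_cast (by omega : t₁ ≤ t)

end Combined

/-! ### Completely positive trace-preserving maps -/

section CPTP

variable {ι κ μ Ω : Type} [Fintype ι] [DecidableEq ι] [Fintype κ] [DecidableEq κ] [Fintype μ]
  [DecidableEq μ] [Fintype Ω] [DecidableEq Ω]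

theorem IsCPTP.comp {Ψ : Matrix κ κ ℂ →ₗ[ℂ] Matrix μ μ ℂ} {Φ : Matrix ι ι ℂ →ₗ[ℂ] Matrix κ κ ℂ}
    (hΨ : IsCPTP Ψ) (hΦ : IsCPTP Φ) : IsCPTP (Ψ ∘ₗ Φ) := by
  obtain ⟨r, _, V, hV, hV1⟩ := hΦ
  obtain ⟨q, _, W, hW, hW1⟩ := hΨ
  refine ⟨q × r, inferInstance, fun x => W x.1 * V x.2, fun X => ?_, ?_⟩
  · rw [LinearMap.comp_apply, hV, hW, Fintype.sum_prod_type]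
    refine Finset.sum_congr rfl fun b _ => ?_
    simp only [Matrix.mul_sum, Matrix.sum_mul, Matrix.conjTranspose_mul, Matrix.mul_assoc]
  · rw [Fintype.sum_prod_type, Finset.sum_comm, ← hV1]
    refine Finset.sum_congr rfl fun a _ => ?_
    calc ∑ b, (W b * V a).conjTranspose * (W b * V a)
        = (V a).conjTranspose * (∑ b, (W b).conjTranspose * W b) * V a := by
          simp only [Matrix.conjTranspose_mul, Matrix.mul_sum, Matrix.sum_mul, Matrix.mul_assoc]
      _ = _ := by rw [hW1, Matrix.mul_one]

/-- Conjugation `X ↦ V X Vᴴ`. -/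
def conjMap (V : Matrix κ ι ℂ) : Matrix ι ι ℂ →ₗ[ℂ] Matrix κ κ ℂ where
  toFun X := V * X * V.conjTranspose
  map_add' X Y := by simp [Matrix.mul_add, Matrix.add_mul]
  map_smul' z X := by simp

theorem conjMap_apply (V : Matrix κ ι ℂ) (X : Matrix ι ι ℂ) :
    conjMap V X = V * X * V.conjTranspose := rfl

theorem isCPTP_conjMap {V : Matrix κ ι ℂ} (hV : V.conjTranspose * V = 1) : IsCPTP (conjMap V) :=
  ⟨Unit, inferInstance, fun _ => V, fun X => by simp [conjMap_apply], by simpa using hV⟩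

theorem isCPTP_reindex (e : ι ≃ κ) : IsCPTP (Matrix.reindexLinearEquiv ℂ ℂ e e).toLinearMap := by
  refine ⟨Unit, inferInstance, fun _ => (1 : Matrix ι ι ℂ).submatrix e.symm id, fun X => ?_, ?_⟩
  · ext a b
    simp [Matrix.mul_apply, Matrix.one_apply]
  · ext a b
    simp [Matrix.one_apply, apply_ite]

/-- Apply a random unitary and record its index. -/
noncomputable def registerMap (U : Ω → Matrix ι ι ℂ) :
    Matrix ι ι ℂ →ₗ[ℂ] Matrix (Ω × ι) (Ω × ι) ℂ where
  toFun X := (1 / Fintype.card Ω : ℂ) • ∑ r, proj r ⊗ₖ conjMap (U r) X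
  map_add' X Y := by
    simp only [map_add, Matrix.kronecker_add, Finset.sum_add_distrib, smul_add]
  map_smul' z X := by
    simp only [map_smul, Matrix.kronecker_smul, ← Finset.smul_sum, RingHom.id_apply]
    rw [smul_comm]

theorem registerMap_apply (U : Ω → Matrix ι ι ℂ) (X : Matrix ι ι ℂ) :
    registerMap U X = (1 / Fintype.card Ω : ℂ) • ∑ r, proj r ⊗ₖ conjMap (U r) X := rfl

theorem isCPTP_registerMap [Nonempty Ω] {U : Ω → Matrix ι ι ℂ}
    (hU : ∀ r, (U r).conjTranspose * U r = 1) : IsCPTP (registerMap U) := by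
  have hc : ((Fintype.card Ω : ℝ)) ≠ 0 := Nat.cast_ne_zero.2 Fintype.card_ne_zero
  have hsq : ((Real.sqrt (1 / Fintype.card Ω) : ℝ) : ℂ) * ((Real.sqrt (1 / Fintype.card Ω) : ℝ) : ℂ)
      = 1 / Fintype.card Ω := by
    rw [← Complex.ofReal_mul, Real.mul_self_sqrt (by positivity)]
    push_cast
    rfl
  -- `B r` is `|r⟩ ⊗ U r`, and the Kraus operators are these divided by `√|Ω|`.
  let B : Ω → Matrix (Ω × ι) ι ℂ := fun r => Matrix.of fun p j => if p.1 = r then U r p.2 j else 0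
  refine ⟨Ω, inferInstance, fun r => ((Real.sqrt (1 / Fintype.card Ω) : ℝ) : ℂ) • B r,
    fun X => ?_, ?_⟩
  · rw [registerMap_apply, Finset.smul_sum]
    refine Finset.sum_congr rfl fun r _ => ?_
    simp only [Matrix.conjTranspose_smul, Matrix.smul_mul, Matrix.mul_smul, smul_smul,
      RCLike.star_def, Complex.conj_ofReal]
    rw [hsq]
    congr 1
    ext ⟨a, i⟩ ⟨b, j⟩
    simp only [B, proj, conjMap_apply, Matrix.kroneckerMap_apply, Matrix.mul_apply,
      Matrix.conjTranspose_apply, Matrix.of_apply, Matrix.single_apply]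
    by_cases ha : a = r <;> by_cases hb : b = r <;> simp [ha, hb, Ne.symm]
  · have h : ∀ r, (((Real.sqrt (1 / Fintype.card Ω) : ℝ) : ℂ) • B r).conjTranspose *
        (((Real.sqrt (1 / Fintype.card Ω) : ℝ) : ℂ) • B r) = (1 / Fintype.card Ω : ℂ) • 1 := by
      intro r
      simp only [Matrix.conjTranspose_smul, Matrix.smul_mul, Matrix.mul_smul, smul_smul,
        RCLike.star_def, Complex.conj_ofReal]
      rw [hsq, ← hU r]
      congr 1
      ext i j
      simp only [B, Matrix.mul_apply, Matrix.conjTranspose_apply, Matrix.of_apply,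
        Fintype.sum_prod_type]
      rw [Finset.sum_eq_single r]
      · simp
      · intro b _ hb
        simp [hb]
      · simp
    rw [Finset.sum_congr rfl fun r _ => h r, Finset.sum_const, Finset.card_univ,
      ← Nat.cast_smul_eq_nsmul ℂ, smul_smul, mul_one_div_cancel, one_smul]
    exact_mod_cast hc

end CPTP

/-! ### Unitary designs and sampling -/

section Design

/-- Flipping the sign at `i` permutes the sign functions and negates the sum. -/
theorem sum_sign_mul_sign {α : Type} [Fintype α] [DecidableEq α] {i j : α} (h : i ≠ j) :
    ∑ f : α → ℤˣ, (((f i : ℤ) : ℂ) * ((f j : ℤ) : ℂ)) = 0 := by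
  have h1 := Equiv.sum_comp (Equiv.mulRight (Pi.mulSingle i (-1 : ℤˣ)))
    fun f : α → ℤˣ => (((f i : ℤ) : ℂ) * ((f j : ℤ) : ℂ))
  simp only [Equiv.coe_mulRight, Pi.mul_apply, Pi.mulSingle_eq_same, Pi.mulSingle_eq_of_ne h.symm,
    mul_one, mul_neg, Units.val_neg, Int.cast_neg, neg_mul, Finset.sum_neg_distrib] at h1
  have h2 := add_self_eq_zero.1 (neg_eq_iff_add_eq_zero.1 h1)
  exact h2

/-- A finite family of unitaries that averages every operator to a multiple of the identity. -/
theorem exists_unitary_design {d : ℕ} (hd : 0 < d) :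
    ∃ (G : Type) (_ : Fintype G) (_ : DecidableEq G) (_ : Nonempty G)
      (V : G → Matrix (Fin d) (Fin d) ℂ), (∀ g, (V g).conjTranspose * V g = 1) ∧
      ∀ σ : Matrix (Fin d) (Fin d) ℂ, ∑ g, conjMap (V g) σ =
        (Fintype.card G * (1 / d) * σ.trace : ℂ) • 1 := by
  have : NeZero d := ⟨hd.ne'⟩
  -- A diagonal of signs followed by a cyclic shift. The signs average the off-diagonal entries to
  -- zero and the shifts average the diagonal, in every dimension.
  let V : Fin d × (Fin d → ℤˣ) → Matrix (Fin d) (Fin d) ℂ := fun g =>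
    Matrix.of fun i j => if j = i - g.1 then ((g.2 j : ℤ) : ℂ) else 0
  have hconj : ∀ g σ i j, conjMap (V g) σ i j =
      ((g.2 (i - g.1) : ℤ) : ℂ) * ((g.2 (j - g.1) : ℤ) : ℂ) * σ (i - g.1) (j - g.1) := by
    intro g σ i j
    simp [V, conjMap_apply, Matrix.mul_apply, Matrix.conjTranspose_apply, apply_ite]
    ring
  have hunit : ∀ u : ℤˣ, ((u : ℤ) : ℂ) * ((u : ℤ) : ℂ) = 1 := by
    intro u
    rw [← Int.cast_mul, ← Units.val_mul, Int.units_mul_self]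
    simp
  refine ⟨Fin d × (Fin d → ℤˣ), inferInstance, inferInstance, ⟨(0, 1)⟩, V, fun g => ?_,
    fun σ => ?_⟩
  -- The conjugation formula at the identity gives `V Vᴴ = 1`, which for square matrices is the same
  -- as `Vᴴ V = 1`.
  · rw [mul_eq_one_comm]
    have := hconj g 1
    rw [conjMap_apply, Matrix.mul_one] at this
    ext i j
    rw [this, Matrix.one_apply, Matrix.one_apply]
    by_cases hij : i = j
    · simp [hij, hunit]
    · simp [hij]
  · ext i j
    rw [Matrix.sum_apply, Fintype.sum_prod_type]
    simp only [hconj, ← Finset.sum_mul]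
    by_cases hij : i = j
    · subst hij
      simp only [hunit]
      have h : ∑ a, σ (i - a) (i - a) = σ.trace :=
        Equiv.sum_comp (Equiv.subLeft i) fun k => σ k k
      rw [← Finset.mul_sum, h]
      have : (d : ℂ) ≠ 0 := Nat.cast_ne_zero.2 hd.ne'
      simp
      field_simp
      simp
    · rw [Finset.sum_eq_zero]
      · simp [hij]
      · intro a _
        rw [sum_sign_mul_sign (fun h => hij (sub_left_injective h)), zero_mul]

/-! ### Second moments of independent uniform samples. -/

variable {S G : Type} [Fintype S] [DecidableEq S] [Fintype G]

/-- For a uniform function `r` the values at distinct points are independent, and `w` has mean zero.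
-/
theorem sum_comp_mul_comp_eq_zero {w v : G → ℂ} (hw : ∑ g, w g = 0) {s s' : S} (h : s ≠ s') :
    ∑ r : S → G, w (r s) * v (r s') = 0 := by
  rw [← (Equiv.funSplitAt s G).symm.sum_comp, Fintype.sum_prod_type, Finset.sum_comm]
  refine Finset.sum_eq_zero fun r _ => ?_
  simp only [Equiv.funSplitAt_symm_apply, dif_pos, dif_neg h.symm]
  rw [← Finset.sum_mul, hw, zero_mul]

theorem card_mul_sum_comp (w : G → ℂ) (s : S) :
    (Fintype.card G : ℂ) * ∑ r : S → G, w (r s) = Fintype.card (S → G) * ∑ g, w g := by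
  rw [← (Equiv.funSplitAt s G).symm.sum_comp, Fintype.sum_prod_type,
    Fintype.card_congr (Equiv.funSplitAt s G)]
  simp [Equiv.funSplitAt_symm_apply, Finset.mul_sum, mul_assoc]

/-- The variance of a sum of independent uniform samples. -/
theorem card_mul_sum_norm_sq_sum_comp {w : G → ℂ} (hw : ∑ g, w g = 0) :
    (Fintype.card G : ℝ) * ∑ r : S → G, ‖∑ s, w (r s)‖ ^ 2 =
      Fintype.card S * Fintype.card (S → G) * ∑ g, ‖w g‖ ^ 2 := by
  have h : ∀ r : S → G, ((‖∑ s, w (r s)‖ ^ 2 : ℝ) : ℂ) =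
      ∑ s, ∑ s', w (r s) * (starRingEnd ℂ) (w (r s')) := by
    intro r
    rw [Complex.ofReal_pow, ← Complex.mul_conj', map_sum, Finset.sum_mul_sum]
  have h2 : (Fintype.card G : ℂ) * ∑ r : S → G, ((‖∑ s, w (r s)‖ ^ 2 : ℝ) : ℂ) =
      Fintype.card S * Fintype.card (S → G) * ∑ g, ((‖w g‖ ^ 2 : ℝ) : ℂ) := by
    simp only [h]
    rw [Finset.sum_comm]
    have h3 : ∀ s : S, ∑ r : S → G, ∑ s', w (r s) * (starRingEnd ℂ) (w (r s')) =
        ∑ r : S → G, ((‖w (r s)‖ ^ 2 : ℝ) : ℂ) := by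
      intro s
      rw [Finset.sum_comm, Finset.sum_eq_single s]
      · refine Finset.sum_congr rfl fun r _ => ?_
        rw [Complex.mul_conj', Complex.ofReal_pow]
      · intro s' _ hs'
        exact sum_comp_mul_comp_eq_zero (v := fun g => (starRingEnd ℂ) (w g)) hw hs'.symm
      · simp
    rw [Finset.sum_congr rfl fun s _ => h3 s, Finset.mul_sum,
      Finset.sum_congr rfl fun s _ => card_mul_sum_comp (fun g => ((‖w g‖ ^ 2 : ℝ) : ℂ)) s]
    simp [mul_assoc]
  exact_mod_cast h2

/-- With `ρ = Bᴴ B`, Cauchy-Schwarz bounds each `|ρ i j|²` by the product of the diagonal entries `ρ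
i i` and `ρ j j`, and these products sum to the square of the trace. -/
theorem IsDensity.sum_norm_sq_le_one {ι : Type} [Fintype ι] [DecidableEq ι] {ρ : Matrix ι ι ℂ}
    (hρ : IsDensity ρ) : ∑ i, ∑ j, ‖ρ i j‖ ^ 2 ≤ 1 := by
  obtain ⟨B, hB⟩ := exists_conjTranspose_mul_self hρ.1
  have h1 : ∑ i, ∑ k, ‖B k i‖ ^ 2 = 1 := by
    have h2 := hρ.2
    rw [hB] at h2
    simp only [Matrix.trace, Matrix.diag_apply, Matrix.mul_apply, Matrix.conjTranspose_apply,
      RCLike.star_def, Complex.conj_mul'] at h2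
    exact_mod_cast h2
  calc ∑ i, ∑ j, ‖ρ i j‖ ^ 2 ≤ ∑ i, ∑ j, (∑ k, ‖B k i‖ ^ 2) * (∑ k, ‖B k j‖ ^ 2) := by
        refine Finset.sum_le_sum fun i _ => Finset.sum_le_sum fun j _ => ?_
        refine le_trans ?_ (Finset.sum_mul_sq_le_sq_mul_sq _ _ _)
        rw [hB, Matrix.mul_apply]
        refine pow_le_pow_left₀ (norm_nonneg _) ((norm_sum_le _ _).trans (le_of_eq ?_)) 2
        simp
    _ = 1 := by rw [← Finset.sum_mul_sum, h1, one_mul]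

end Design

/-! ### Approximate one-time pads -/

section Pad

/-- Relabelling the basis of the cipher space. -/
noncomputable def ClassicalKeyQSR.reindex {S R D D' : Type} [Fintype S] [Fintype R] [DecidableEq R]
    [Fintype D] [DecidableEq D] [Fintype D'] [DecidableEq D'] (P : ClassicalKeyQSR S R D)
    (e : D ≃ D') : ClassicalKeyQSR S R D' where
  prob := P.prob
  prob_nonneg := P.prob_nonneg
  prob_sum := P.prob_sum
  enc s := (Matrix.reindexLinearEquiv ℂ ℂ e e).toLinearMap ∘ₗ P.enc s
  enc_cptp s := (isCPTP_reindex e).comp (P.enc_cptp s)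

theorem ClassicalKeyQSR.Invertible.reindex {S R D D' : Type} [Fintype S] [Fintype R]
    [DecidableEq R] [Fintype D] [DecidableEq D] [Fintype D'] [DecidableEq D']
    {P : ClassicalKeyQSR S R D} (hP : P.Invertible) (e : D ≃ D') : (P.reindex e).Invertible := by
  intro s hs
  obtain ⟨Dec, h1, h2⟩ := hP s hs
  refine ⟨_, h1.comp (isCPTP_reindex e.symm), fun σ hσ => ?_⟩
  rw [← h2 σ hσ]
  simp only [ClassicalKeyQSR.reindex, LinearMap.comp_apply]
  congr 1
  ext i j
  simp [h2 σ hσ]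

theorem ClassicalKeyQSR.Randomizing.reindex {S R D D' : Type} [Fintype S] [Fintype R]
    [DecidableEq R] [Fintype D] [DecidableEq D] [Fintype D'] [DecidableEq D']
    {P : ClassicalKeyQSR S R D} {ε : ℝ} (hP : P.Randomizing ε) (e : D ≃ D') :
    (P.reindex e).Randomizing ε := by
  obtain ⟨τ, hτ, h⟩ := hP
  refine ⟨τ.submatrix e.symm e.symm, hτ.submatrix e.symm, fun σ hσ => ?_⟩
  have h1 : IsDensity (∑ s, (P.prob s : ℂ) • P.enc s σ) :=
    IsDensity.sum P.prob_nonneg P.prob_sum fun s => (P.enc_cptp s).isDensity hσ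
  have h2 := ((trLE_iff (h1.isHermitian.sub hτ.isHermitian)).2 (h σ hσ)).submatrix e.symm
  convert h2.trNorm_le using 2
  ext i j
  simp [ClassicalKeyQSR.reindex, Matrix.sum_apply]

variable {S G R : Type} [Fintype S] [DecidableEq S] [Nonempty S] [Fintype G] [DecidableEq G]
  [Nonempty G] [Fintype R] [DecidableEq R]

/-- The pad that applies the unitary `V (r s)`, where the function `r` is drawn uniformly at
random and is part of the cipher. -/
noncomputable def designPad (V : G → Matrix R R ℂ) (hV : ∀ g, (V g).conjTranspose * V g = 1) :
    ClassicalKeyQSR S R ((S → G) × R) where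
  prob _ := 1 / (Fintype.card S : ℝ)
  prob_nonneg _ := by positivity
  prob_sum := by simp
  enc s := registerMap fun r : S → G => V (r s)
  enc_cptp s := isCPTP_registerMap fun _ => hV _

theorem designPad_invertible (V : G → Matrix R R ℂ) (hV : ∀ g, (V g).conjTranspose * V g = 1) :
    (designPad (S := S) V hV).Invertible := by
  intro s _
  have hV' : ∀ g, (V g).conjTranspose.conjTranspose * (V g).conjTranspose = 1 := fun g => by
    rw [Matrix.conjTranspose_conjTranspose, mul_eq_one_comm, hV]
  refine ⟨blockMap fun r : S → G => conjMap (V (r s)).conjTranspose,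
    isCPTP_blockMap fun r => isCPTP_conjMap (hV' _), fun σ _ => ?_⟩
  change blockMap _ (registerMap (fun r : S → G => V (r s)) σ) = σ
  rw [registerMap_apply, map_smul, map_sum]
  have h : ∀ r : S → G, blockMap (fun r : S → G => conjMap (V (r s)).conjTranspose)
      (proj r ⊗ₖ conjMap (V (r s)) σ) = σ := by
    intro r
    rw [blockMap_proj_kronecker, conjMap_apply, conjMap_apply, Matrix.conjTranspose_conjTranspose]
    calc _ = ((V (r s)).conjTranspose * V (r s)) * σ * ((V (r s)).conjTranspose * V (r s)) := by
          simp only [Matrix.mul_assoc]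
      _ = σ := by rw [hV, Matrix.one_mul, Matrix.mul_one]
  rw [Finset.sum_congr rfl fun r _ => h r, Finset.sum_const, Finset.card_univ,
    ← Nat.cast_smul_eq_nsmul ℂ, smul_smul, one_div, inv_mul_cancel₀, one_smul]
  exact Nat.cast_ne_zero.2 Fintype.card_ne_zero

theorem isDensity_maximallyMixed [Nonempty R] :
    IsDensity ((1 / Fintype.card R : ℂ) • (1 : Matrix R R ℂ)) := by
  constructor
  · refine Matrix.PosSemidef.one.smul ?_
    simp
  · rw [Matrix.trace_smul, Matrix.trace_one, smul_eq_mul, one_div_mul_cancel]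
    exact Nat.cast_ne_zero.2 Fintype.card_ne_zero

/-- Since `r` is part of the cipher, the deviation is block diagonal and its trace norm is the mean
of the norms of the blocks `B r`. Each entry of `B r` averages `|S|` independent samples of mean
zero, by the design property, so the mean squared Frobenius norm is at most `4 / |S|`. Passing to
the trace norm costs a factor `dim R` in the square. -/
theorem designPad_randomizing [Nonempty R] (V : G → Matrix R R ℂ)
    (hV : ∀ g, (V g).conjTranspose * V g = 1)
    (hV1 : ∀ σ : Matrix R R ℂ, ∑ g, conjMap (V g) σ =
      (Fintype.card G * (1 / Fintype.card R) * σ.trace : ℂ) • 1) {ε : ℝ} (hε : 0 ≤ ε)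
    (hS : 4 * Fintype.card R ≤ Fintype.card S * ε ^ 2) :
    (designPad (S := S) V hV).Randomizing ε := by
  set μ : Matrix R R ℂ := (1 / Fintype.card R : ℂ) • 1 with hμ
  have hμd : IsDensity μ := isDensity_maximallyMixed
  refine ⟨(1 / Fintype.card (S → G) : ℂ) • ∑ r : S → G, proj r ⊗ₖ μ,
    IsDensity.average fun r => (isDensity_proj r).kronecker hμd, fun σ hσ => TrLE.trNorm_le ?_⟩
  have hW : ∀ g, IsDensity (conjMap (V g) σ) := fun g => (isCPTP_conjMap (hV g)).isDensity hσ
  let B : (S → G) → Matrix R R ℂ := fun r =>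
    (1 / Fintype.card S : ℂ) • ∑ s, conjMap (V (r s)) σ - μ
  have hB : ∀ r, (B r).IsHermitian := fun r =>
    (IsDensity.average fun s => hW (r s)).isHermitian.sub hμd.isHermitian
  have heq : ∑ s, ((designPad (S := S) V hV).prob s : ℂ) • (designPad (S := S) V hV).enc s σ -
      (1 / Fintype.card (S → G) : ℂ) • ∑ r : S → G, proj r ⊗ₖ μ =
      ((1 / Fintype.card (S → G) : ℝ) : ℂ) • ∑ r : S → G, proj r ⊗ₖ B r := by
    simp only [designPad, registerMap_apply, B]
    ext ⟨a, i⟩ ⟨b, j⟩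
    simp only [Matrix.sub_apply, Matrix.sum_apply, Matrix.smul_apply, Matrix.kroneckerMap_apply,
      smul_eq_mul, mul_sub, Finset.sum_sub_distrib, Finset.mul_sum]
    rw [Finset.sum_comm]
    push_cast
    congr 1
    refine Finset.sum_congr rfl fun r _ => Finset.sum_congr rfl fun s _ => ?_
    ring
  rw [heq]
  have h1 := (TrLE.sum Finset.univ fun r (_ : r ∈ Finset.univ) =>
    (trLE_trNorm (hB r)).kronecker_left (isDensity_proj r)).smul
    (r := 1 / Fintype.card (S → G)) (by positivity)
  refine h1.mono ?_
  have hcS : (0 : ℝ) < Fintype.card S := Nat.cast_pos.2 Fintype.card_pos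
  have hcG : (0 : ℝ) < Fintype.card G := Nat.cast_pos.2 Fintype.card_pos
  have hcF : (0 : ℝ) < Fintype.card (S → G) := Nat.cast_pos.2 Fintype.card_pos
  have hcR : (0 : ℝ) < Fintype.card R := Nat.cast_pos.2 Fintype.card_pos
  let w : R → R → G → ℂ := fun i j g => (conjMap (V g) σ - μ) i j
  have hw : ∀ i j, ∑ g, w i j g = 0 := by
    intro i j
    have h2 := congrFun (congrFun (hV1 σ) i) j
    rw [hσ.2, Matrix.sum_apply] at h2
    simp only [w, Matrix.sub_apply, Finset.sum_sub_distrib, h2, hμ, Matrix.smul_apply, smul_eq_mul,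
      Finset.sum_const, Finset.card_univ, nsmul_eq_mul]
    ring
  have hBw : ∀ r i j, B r i j = (1 / Fintype.card S : ℂ) * ∑ s, w i j (r s) := by
    intro r i j
    have : (Fintype.card S : ℂ) ≠ 0 := Nat.cast_ne_zero.2 Fintype.card_ne_zero
    simp only [B, w, Matrix.sub_apply, Matrix.smul_apply, Matrix.sum_apply, smul_eq_mul,
      Finset.sum_sub_distrib, Finset.sum_const, Finset.card_univ, nsmul_eq_mul]
    field_simp
  -- From `(a + b)² ≤ 2 a² + 2 b²`, as both states have Frobenius norm at most one.
  have hw4 : ∀ g, ∑ i, ∑ j, ‖w i j g‖ ^ 2 ≤ 4 := by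
    intro g
    calc ∑ i, ∑ j, ‖w i j g‖ ^ 2
        ≤ ∑ i, ∑ j, (2 * ‖conjMap (V g) σ i j‖ ^ 2 + 2 * ‖μ i j‖ ^ 2) := by
          refine Finset.sum_le_sum fun i _ => Finset.sum_le_sum fun j _ => ?_
          have h3 := norm_sub_le (conjMap (V g) σ i j) (μ i j)
          have h4 : ‖w i j g‖ ^ 2 ≤ (‖conjMap (V g) σ i j‖ + ‖μ i j‖) ^ 2 :=
            pow_le_pow_left₀ (norm_nonneg _) h3 2
          nlinarith [sq_nonneg (‖conjMap (V g) σ i j‖ - ‖μ i j‖)]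
      _ = 2 * ∑ i, ∑ j, ‖conjMap (V g) σ i j‖ ^ 2 + 2 * ∑ i, ∑ j, ‖μ i j‖ ^ 2 := by
          simp only [Finset.sum_add_distrib, Finset.mul_sum]
      _ ≤ 4 := by linarith [(hW g).sum_norm_sq_le_one, hμd.sum_norm_sq_le_one]
  have hsum : (Fintype.card S : ℝ) * ∑ r, ∑ i, ∑ j, ‖B r i j‖ ^ 2 ≤ 4 * Fintype.card (S → G) := by
    have h5 : ∀ i j, (Fintype.card S : ℝ) * ∑ r, ‖B r i j‖ ^ 2 =
        Fintype.card (S → G) / Fintype.card G * ∑ g, ‖w i j g‖ ^ 2 := by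
      intro i j
      have h6 := card_mul_sum_norm_sq_sum_comp (S := S) (hw i j)
      simp only [hBw, norm_mul, mul_pow, ← Finset.mul_sum]
      have h7 : ‖(1 / Fintype.card S : ℂ)‖ = 1 / Fintype.card S := by simp
      rw [h7]
      field_simp
      linarith
    calc (Fintype.card S : ℝ) * ∑ r, ∑ i, ∑ j, ‖B r i j‖ ^ 2
        = ∑ i, ∑ j, (Fintype.card S : ℝ) * ∑ r, ‖B r i j‖ ^ 2 := by
          rw [Finset.sum_comm, Finset.mul_sum]
          refine Finset.sum_congr rfl fun i _ => ?_
          rw [Finset.sum_comm, Finset.mul_sum]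
      _ = Fintype.card (S → G) / Fintype.card G * ∑ g, ∑ i, ∑ j, ‖w i j g‖ ^ 2 := by
          simp only [h5, ← Finset.mul_sum]
          congr 1
          rw [Finset.sum_comm (s := (Finset.univ : Finset G))]
          exact Finset.sum_congr rfl fun i _ => Finset.sum_comm
      _ ≤ Fintype.card (S → G) / Fintype.card G * ∑ g : G, 4 :=
          mul_le_mul_of_nonneg_left (Finset.sum_le_sum fun g _ => hw4 g) (by positivity)
      _ = 4 * Fintype.card (S → G) := by
          rw [Finset.sum_const, Finset.card_univ, nsmul_eq_mul]
          field_simp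
  have hnn : 0 ≤ ∑ r, trNorm (B r) := Finset.sum_nonneg fun r _ => (trLE_trNorm (hB r)).nonneg
  -- Cauchy-Schwarz twice: over `r`, and over the singular values of each `B r`.
  have hsq : (∑ r, trNorm (B r)) ^ 2 ≤
      Fintype.card (S → G) * (Fintype.card R * ∑ r, ∑ i, ∑ j, ‖B r i j‖ ^ 2) := by
    refine (sq_sum_le_card_mul_sum_sq (s := Finset.univ)).trans ?_
    rw [Finset.card_univ, Finset.mul_sum (s := Finset.univ) (a := (Fintype.card R : ℝ))]
    exact mul_le_mul_of_nonneg_left (Finset.sum_le_sum fun r _ => trNorm_sq_le_card_mul _) hcF.le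
  rw [one_div, inv_mul_le_iff₀ hcF]
  refine le_of_sq_le_sq ?_ (by positivity)
  refine hsq.trans ?_
  have h8 : (Fintype.card S : ℝ) * (Fintype.card R * ∑ r, ∑ i, ∑ j, ‖B r i j‖ ^ 2) ≤
      Fintype.card S * (Fintype.card (S → G) * ε ^ 2) := by
    nlinarith
  have h9 := le_of_mul_le_mul_left h8 hcS
  nlinarith

/-- The cipher space is huge, since it carries the function `r`, but only the length of the secret
index `s` counts as key. -/
theorem exists_pad {m d : ℕ} {ε : ℝ} (hd : 0 < d) (hε : 0 ≤ ε) (hm : 4 * d ≤ 2 ^ m * ε ^ 2) :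
    ∃ (e : ℕ) (P : ClassicalKeyQSR (Bits m) (Fin d) (Fin e)),
      P.UniformKey ∧ P.Invertible ∧ P.Randomizing ε := by
  obtain ⟨G, _, _, _, V, hV, hV1⟩ := exists_unitary_design hd
  have : Nonempty (Fin d) := ⟨⟨0, hd⟩⟩
  let e := Fintype.equivFin ((Bits m → G) × Fin d)
  refine ⟨_, (designPad (S := Bits m) V hV).reindex e, fun s => rfl,
    (designPad_invertible V hV).reindex e, (designPad_randomizing V hV ?_ hε ?_).reindex e⟩
  · simpa using hV1
  · simpa [ZMod.card] using hm

end Pad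

/-! ### Square roots and trace inequalities -/

section Fidelity

variable {ι κ : Type} [Fintype ι] [DecidableEq ι] [Fintype κ] [DecidableEq κ]

/-- A positive operator `ω` has a positive square root `S` and a (pseudo)inverse `W` of it. -/
theorem exists_sqrt_and_inverse {ω : Matrix ι ι ℂ} (hω : ω.PosSemidef) :
    ∃ S W : Matrix ι ι ℂ, S.PosSemidef ∧ W.IsHermitian ∧ S * S = ω ∧ W * ω = S ∧
      (1 - W * ω * W).PosSemidef := by
  obtain ⟨U, hU, hU', hd⟩ := exists_unitary_diagonalization hω.isHermitian
  set l := hω.isHermitian.eigenvalues with hl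
  have hl0 : ∀ i, 0 ≤ l i := hω.eigenvalues_nonneg
  let F : (ι → ℝ) → Matrix ι ι ℂ := fun f =>
    U * Matrix.diagonal (fun i => (f i : ℂ)) * U.conjTranspose
  have hF : ∀ f g, F f * F g = F fun i => f i * g i := by
    intro f g
    calc F f * F g = U * (Matrix.diagonal (fun i => (f i : ℂ)) * (U.conjTranspose * U) *
          Matrix.diagonal (fun i => (g i : ℂ))) * U.conjTranspose := by
          simp only [F, Matrix.mul_assoc]
      _ = _ := by
          rw [hU, Matrix.mul_one, Matrix.diagonal_mul_diagonal]
          simp only [F, Complex.ofReal_mul]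
  have hFp : ∀ f : ι → ℝ, (∀ i, 0 ≤ f i) → (F f).PosSemidef := by
    intro f hf
    refine Matrix.PosSemidef.mul_mul_conjTranspose_same
      (Matrix.PosSemidef.diagonal fun i => ?_) U
    simpa using hf i
  have hωF : ω = F l := hd
  -- The convention `0⁻¹ = 0` makes `W` vanish on the kernel of `ω`, so `W ω W` is the projector
  -- onto the support and not the identity.
  have hW0 : ∀ i, 0 ≤ (Real.sqrt (l i))⁻¹ := fun i => inv_nonneg.2 (Real.sqrt_nonneg _)
  refine ⟨F fun i => Real.sqrt (l i), F fun i => (Real.sqrt (l i))⁻¹, hFp _ fun i =>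
    Real.sqrt_nonneg _, (hFp _ hW0).isHermitian, ?_, ?_, ?_⟩
  · rw [hF, hωF]
    congr 1
    funext i
    exact Real.mul_self_sqrt (hl0 i)
  · rw [hωF, hF]
    congr 1
    funext i
    rcases eq_or_ne (Real.sqrt (l i)) 0 with h | h
    · simp [h]
    · rw [inv_mul_eq_iff_eq_mul₀ h, Real.mul_self_sqrt (hl0 i)]
  · have h1 : (1 : Matrix ι ι ℂ) = F fun _ => 1 := by simp [F, hU']
    have h2 : ∀ f g, F f - F g = F fun i => f i - g i := by
      intro f g
      simp only [F, ← Matrix.sub_mul, ← Matrix.mul_sub, Matrix.diagonal_sub, Complex.ofReal_sub]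
    rw [h1, hωF, hF, hF, h2]
    refine hFp _ fun i => ?_
    rw [sub_nonneg, mul_right_comm, ← mul_inv, Real.mul_self_sqrt (hl0 i)]
    exact inv_mul_le_one

/-- With `A = Cᴴ C` and `B = Dᴴ D` the trace is the squared Hilbert-Schmidt norm of `D Cᴴ`. -/
theorem mul_eq_zero_of_trace_mul_eq_zero {A B : Matrix ι ι ℂ} (hA : A.PosSemidef)
    (hB : B.PosSemidef) (h : (A * B).trace = 0) : A * B = 0 := by
  obtain ⟨C, rfl⟩ := exists_conjTranspose_mul_self hA
  obtain ⟨D, rfl⟩ := exists_conjTranspose_mul_self hB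
  have h1 : ((D * C.conjTranspose).conjTranspose * (D * C.conjTranspose)).trace = 0 := by
    rw [← h, Matrix.mul_assoc, Matrix.trace_mul_comm C.conjTranspose]
    simp only [Matrix.conjTranspose_mul, Matrix.conjTranspose_conjTranspose, Matrix.mul_assoc]
  rw [Matrix.trace_conjTranspose_mul_self_eq_zero_iff] at h1
  have h2 : C * D.conjTranspose = 0 := by
    have := congrArg Matrix.conjTranspose h1
    simpa using this
  calc C.conjTranspose * C * (D.conjTranspose * D)
      = C.conjTranspose * (C * D.conjTranspose) * D := by simp only [Matrix.mul_assoc]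
    _ = 0 := by rw [h2, Matrix.mul_zero, Matrix.zero_mul]

/-- The Cauchy-Schwarz inequality for the Hilbert-Schmidt inner product. -/
theorem trace_conjTranspose_mul_re_sq_le (X Y : Matrix ι ι ℂ) :
    (X.conjTranspose * Y).trace.re ^ 2 ≤
      (X.conjTranspose * X).trace.re * (Y.conjTranspose * Y).trace.re := by
  rw [trace_conjTranspose_mul_self, trace_conjTranspose_mul_self, Complex.ofReal_re,
    Complex.ofReal_re, ← Fintype.sum_prod_type', ← Fintype.sum_prod_type']
  refine le_trans ?_ (Finset.sum_mul_sq_le_sq_mul_sq _ _ _)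
  have h : ‖(X.conjTranspose * Y).trace‖ ≤ ∑ p : ι × ι, ‖X p.1 p.2‖ * ‖Y p.1 p.2‖ := by
    simp only [Matrix.trace, Matrix.diag_apply, Matrix.mul_apply, Matrix.conjTranspose_apply]
    rw [Finset.sum_comm, ← Fintype.sum_prod_type']
    refine (norm_sum_le _ _).trans (le_of_eq ?_)
    simp
  rw [← sq_abs]
  exact pow_le_pow_left₀ (abs_nonneg _) ((Complex.abs_re_le_norm _).trans h) 2

/-- The Powers-Størmer inequality. -/
theorem TrLE.trace_sqrt_sub_sq_le {S T : Matrix ι ι ℂ} (hS : S.PosSemidef) (hT : T.PosSemidef)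
    {ε : ℝ} (h : TrLE (S * S - T * T) ε) : ((S - T) * (S - T)).trace.re ≤ ε := by
  have hD := hS.isHermitian.sub hT.isHermitian
  obtain ⟨U, hU, hU', hd⟩ := exists_unitary_diagonalization hD
  set l := hD.eigenvalues
  set L : Matrix ι ι ℂ := Matrix.diagonal (fun i => (l i : ℂ)) with hL
  have hconj : ∀ X Y : Matrix ι ι ℂ, U.conjTranspose * (X * Y) * U =
      (U.conjTranspose * X * U) * (U.conjTranspose * Y * U) := by
    intro X Y
    calc _ = U.conjTranspose * X * (1 : Matrix ι ι ℂ) * Y * U := by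
          simp only [Matrix.mul_assoc, Matrix.one_mul]
      _ = _ := by rw [← hU']; simp only [Matrix.mul_assoc]
  have hdL : U.conjTranspose * (S - T) * U = L := conj_eq_diagonal hU hd
  set Q := U.conjTranspose * (S + T) * U with hQ
  -- The identity `2 (S² - T²) = (S - T)(S + T) + (S + T)(S - T)`, read in the eigenbasis of `S -
  -- T`, makes the diagonal entries of `S² - T²` equal to `l i * Q i i`.
  have h2 : (2 : ℂ) • (U.conjTranspose * (S * S - T * T) * U) = L * Q + Q * L := by
    rw [← hdL, hQ, ← hconj, ← hconj, ← Matrix.add_mul, ← Matrix.mul_add, ← Matrix.smul_mul,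
      ← Matrix.mul_smul]
    congr 2
    rw [two_smul]
    noncomm_ring
  refine le_trans ?_ (h.sum_abs_diag_le hU')
  rw [← trace_unitary_conj hU', hconj, hdL, hL, Matrix.diagonal_mul_diagonal,
    Matrix.trace_diagonal, Complex.re_sum]
  refine Finset.sum_le_sum fun i _ => ?_
  rw [← Complex.ofReal_mul, Complex.ofReal_re]
  have h3 : (U.conjTranspose * (S * S - T * T) * U) i i = l i * Q i i := by
    have h4 := congrFun (congrFun h2 i) i
    rw [Matrix.smul_apply, Matrix.add_apply, hL, Matrix.diagonal_mul, Matrix.mul_diagonal,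
      smul_eq_mul, mul_comm (Q i i), ← two_mul] at h4
    exact mul_left_cancel₀ two_ne_zero h4
  -- `Q ± L` are conjugates of `2 S` and `2 T`, hence positive, so `|l i| ≤ Q i i` and therefore `(l
  -- i)² ≤ |l i * Q i i|`.
  have hplus : Q + L = (2 : ℂ) • (U.conjTranspose * S * U) := by
    rw [← hdL, hQ, ← Matrix.add_mul, ← Matrix.mul_add, ← Matrix.smul_mul, ← Matrix.mul_smul]
    congr 2
    rw [two_smul]
    abel
  have hminus : Q - L = (2 : ℂ) • (U.conjTranspose * T * U) := by
    rw [← hdL, hQ, ← Matrix.sub_mul, ← Matrix.mul_sub, ← Matrix.smul_mul, ← Matrix.mul_smul]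
    congr 2
    rw [two_smul]
    abel
  have hre : ∀ {A : Matrix ι ι ℂ}, A.PosSemidef →
      0 ≤ (((2 : ℂ) • (U.conjTranspose * A * U)) i i).re := by
    intro A hA
    have := (Complex.le_def.1 ((hA.conjTranspose_mul_mul_same U).diag_nonneg (i := i))).1
    rw [Matrix.smul_apply, smul_eq_mul]
    simpa using this
  have h5 := hre hS
  have h6 := hre hT
  rw [← hplus, Matrix.add_apply, hL, Matrix.diagonal_apply_eq, Complex.add_re,
    Complex.ofReal_re] at h5
  rw [← hminus, Matrix.sub_apply, hL, Matrix.diagonal_apply_eq, Complex.sub_re,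
    Complex.ofReal_re] at h6
  rw [h3, Complex.re_ofReal_mul, abs_mul, ← abs_mul_abs_self]
  refine mul_le_mul_of_nonneg_left (le_trans (abs_le.2 ⟨?_, ?_⟩) (le_abs_self _)) (abs_nonneg _)
  · linarith
  · linarith

/-- If the mixture of the `ρ k` is `ε`-close to `τ`, and the effects `M k` detect the `ρ k` with
certainty, then the distribution `P` has large overlap with weights bounded by `τ (M k)`. -/
theorem exists_overlap {τ : Matrix ι ι ℂ} (hτ : IsDensity τ) {P : κ → ℝ} (hP : ∀ k, 0 ≤ P k)
    (hP1 : ∑ k, P k = 1) {ρ M : κ → Matrix ι ι ℂ} (hρ : ∀ k, IsDensity (ρ k))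
    (hM : ∀ k, 0 < P k → (M k).PosSemidef) (hMρ : ∀ k, 0 < P k → M k * ρ k = ρ k) {ε : ℝ}
    (h : TrLE (∑ k, (P k : ℂ) • ρ k - τ) ε) :
    ∃ f r : κ → ℝ, 1 - ε / 2 ≤ ∑ k, f k ∧ ∑ k, r k ≤ 1 ∧ (∀ k, 0 ≤ r k) ∧
      (∀ k, f k ^ 2 ≤ P k * r k) ∧
      ∀ k, 0 < P k → f k ^ 2 ≤ P k * (τ * M k).trace.re := by
  set ω := ∑ k, (P k : ℂ) • ρ k with hω
  have hωd : IsDensity ω := IsDensity.sum hP hP1 hρ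
  obtain ⟨S, W, hS, hW, hSS, hWS, hWW⟩ := exists_sqrt_and_inverse hωd.1
  obtain ⟨T, -, hT, -, hTT, -, -⟩ := exists_sqrt_and_inverse hτ.1
  have hps : ((S - T) * (S - T)).trace.re ≤ ε :=
    TrLE.trace_sqrt_sub_sq_le hS hT (by rwa [hSS, hTT])
  have hWωW : ∑ k, (P k : ℂ) • (W * ρ k * W) = W * ω * W := by
    rw [hω, Matrix.mul_sum, Matrix.sum_mul]
    exact Finset.sum_congr rfl fun k _ => by rw [Matrix.mul_smul, Matrix.smul_mul]
  have hWρW : ∀ k, ((P k : ℂ) • (W * ρ k * W)).PosSemidef := by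
    intro k
    have := (hρ k).1.mul_mul_conjTranspose_same W
    rw [hW.eq] at this
    exact posSemidef_smul_real this (hP k)
  -- Here `S = √ω`, `T = √τ`, and the operators `P k • W ρ k W` form the square-root measurement of
  -- the mixture `ω`, incomplete off its support. The weight `r k` is the probability of outcome `k`
  -- on `τ`, and the `f k` are the contributions of the keys to `tr (√τ √ω)`.
  refine ⟨fun k => P k * (T * W * ρ k).trace.re,
    fun k => (T * ((P k : ℂ) • (W * ρ k * W)) * T).trace.re, ?_, ?_, fun k => ?_,
    fun k => ?_, fun k hk => ?_⟩
  · have h1 : ∑ k, P k * (T * W * ρ k).trace.re = (T * S).trace.re := by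
      rw [← hWS, ← Matrix.mul_assoc, hω, Matrix.mul_sum, Matrix.trace_sum, Complex.re_sum]
      refine Finset.sum_congr rfl fun k _ => ?_
      rw [Matrix.mul_smul, Matrix.trace_smul, smul_eq_mul, Complex.re_ofReal_mul]
    -- Both states have trace one, so the Powers-Størmer bound `ε` on this trace says that `tr (√τ
    -- √ω)` is at least `1 - ε / 2`.
    have h2 : ((S - T) * (S - T)).trace = 2 - 2 * (T * S).trace := by
      rw [Matrix.mul_sub, Matrix.sub_mul, Matrix.sub_mul, hSS, hTT, Matrix.trace_sub,
        Matrix.trace_sub, Matrix.trace_sub, hωd.2, hτ.2, Matrix.trace_mul_comm S T]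
      ring
    rw [h1]
    rw [h2, Complex.sub_re, Complex.mul_re] at hps
    norm_num at hps
    linarith
  · rw [← Complex.re_sum, ← Matrix.trace_sum, ← Matrix.sum_mul, ← Matrix.mul_sum, hWωW]
    have h1 := hWW.mul_mul_conjTranspose_same T
    rw [hT.isHermitian.eq, Matrix.mul_sub, Matrix.sub_mul, Matrix.mul_one, hTT] at h1
    have h2 := posSemidef_trace_re_nonneg h1
    rw [Matrix.trace_sub, hτ.2, Complex.sub_re, Complex.one_re] at h2
    linarith
  · have := (hWρW k).mul_mul_conjTranspose_same T
    rw [hT.isHermitian.eq] at this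
    exact posSemidef_trace_re_nonneg this
  · obtain ⟨B, hB⟩ := exists_conjTranspose_mul_self (hρ k).1
    have h1 := trace_conjTranspose_mul_re_sq_le (B * W * T) B
    have h2 : ((B * W * T).conjTranspose * B).trace = (T * W * ρ k).trace := by
      simp only [Matrix.conjTranspose_mul, hW.eq, hT.isHermitian.eq, hB, Matrix.mul_assoc]
    have h3 : (B * W * T).conjTranspose * (B * W * T) = T * (W * ρ k * W) * T := by
      simp only [Matrix.conjTranspose_mul, hW.eq, hT.isHermitian.eq, hB, Matrix.mul_assoc]
    rw [h2, h3, ← hB, (hρ k).2, Complex.one_re, mul_one] at h1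
    beta_reduce
    rw [Matrix.mul_smul, Matrix.smul_mul, Matrix.trace_smul, smul_eq_mul, Complex.re_ofReal_mul,
      mul_pow, sq, mul_assoc]
    exact mul_le_mul_of_nonneg_left (mul_le_mul_of_nonneg_left h1 (hP k)) (hP k)
  · obtain ⟨B, hB⟩ := exists_conjTranspose_mul_self (hρ k).1
    obtain ⟨Q, hQ⟩ := exists_conjTranspose_mul_self (hM k hk)
    have hρM : ρ k * M k = ρ k := by
      have := congrArg Matrix.conjTranspose (hMρ k hk)
      rwa [Matrix.conjTranspose_mul, (hM k hk).isHermitian.eq, (hρ k).isHermitian.eq] at this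
    -- As `ρ k = ρ k * M k`, the effect can be inserted into `f k` before Cauchy-Schwarz. The
    -- resulting bound contains `M k` next to `τ`.
    have h1 := trace_conjTranspose_mul_re_sq_le (B * W * T * Q.conjTranspose) (B * Q.conjTranspose)
    have h2 : ((B * W * T * Q.conjTranspose).conjTranspose * (B * Q.conjTranspose)).trace =
        (T * W * ρ k).trace := by
      conv_rhs => rw [← hρM, hB, hQ]
      rw [← Matrix.mul_assoc (T * W), ← Matrix.mul_assoc _ Q.conjTranspose, Matrix.trace_mul_comm _ Q]
      simp only [Matrix.conjTranspose_mul, Matrix.conjTranspose_conjTranspose, hW.eq,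
        hT.isHermitian.eq, Matrix.mul_assoc]
    have h3 : (B * W * T * Q.conjTranspose).conjTranspose * (B * W * T * Q.conjTranspose) =
        Q * (T * (W * ρ k * W) * T) * Q.conjTranspose := by
      simp only [Matrix.conjTranspose_mul, Matrix.conjTranspose_conjTranspose, hW.eq,
        hT.isHermitian.eq, hB, Matrix.mul_assoc]
    have h4 : ((B * Q.conjTranspose).conjTranspose * (B * Q.conjTranspose)).trace = 1 := by
      rw [← (hρ k).2]
      conv_rhs => rw [← hρM, hB, hQ]
      rw [← Matrix.mul_assoc _ Q.conjTranspose, Matrix.trace_mul_comm _ Q]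
      simp only [Matrix.conjTranspose_mul, Matrix.conjTranspose_conjTranspose, Matrix.mul_assoc]
    rw [h2, h3, h4, Complex.one_re, mul_one] at h1
    -- One element of an incomplete measurement is at most the identity; this removes it and leaves
    -- `tr (τ M k)`.
    have h5 : (1 - (P k : ℂ) • (W * ρ k * W)).PosSemidef := by
      have h6 : 1 - (P k : ℂ) • (W * ρ k * W) = (1 - W * ω * W) +
          ∑ j ∈ Finset.univ.erase k, (P j : ℂ) • (W * ρ j * W) := by
        rw [← hWωW, ← Finset.add_sum_erase _ _ (Finset.mem_univ k)]
        abel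
      rw [h6]
      exact hWW.add (Matrix.posSemidef_sum _ fun j _ => hWρW j)
    have h7 := (h5.mul_mul_conjTranspose_same T).mul_mul_conjTranspose_same Q
    rw [hT.isHermitian.eq, Matrix.mul_sub, Matrix.sub_mul, Matrix.mul_one, hTT, Matrix.mul_sub,
      Matrix.sub_mul] at h7
    have h8 := posSemidef_trace_re_nonneg h7
    have h9 : (Q * τ * Q.conjTranspose).trace = (τ * M k).trace := by
      rw [Matrix.mul_assoc, Matrix.trace_mul_comm, hQ, Matrix.mul_assoc]
    rw [Matrix.trace_sub, Complex.sub_re, h9, Matrix.mul_smul, Matrix.smul_mul, Matrix.mul_smul,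
      Matrix.smul_mul, Matrix.trace_smul, smul_eq_mul, Complex.re_ofReal_mul] at h8
    rw [mul_pow, sq, mul_assoc]
    refine mul_le_mul_of_nonneg_left ?_ (hP k)
    linarith [mul_le_mul_of_nonneg_left h1 (hP k)]

end Fidelity

/-! ### The lower bound on the key entropy -/

section LowerBound

variable {ι κ X : Type} [Fintype ι] [DecidableEq ι] [Fintype κ] [DecidableEq κ] [Fintype X]
  [Nonempty X]

/-- A distribution of overlap at least `1 - ε / 2` with subnormalized amplitudes bounded by
`1 / √N` has entropy at least `(1 - 8 ε) log N - 2`. -/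
theorem le_entropy_of_overlap {P b : κ → ℝ} (hP : ∀ k, 0 ≤ P k) (hP1 : ∑ k, P k = 1) {N ε : ℝ}
    (hN : 1 ≤ N) (hε : 0 ≤ ε) (hb1 : ∑ k, b k ^ 2 ≤ 1) (hbN : ∀ k, b k ^ 2 ≤ 1 / N)
    (hPb : 1 - ε / 2 ≤ ∑ k, Real.sqrt (P k) * b k) :
    (1 - 8 * ε) * Real.logb 2 N - 2 ≤ entropy P := by
  classical
  have hN0 : 0 < N := by linarith
  have hL : 0 ≤ Real.logb 2 N := Real.logb_nonneg one_lt_two hN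
  -- Expanding the square gives at most `1 - 2 (1 - ε / 2) + 1`.
  have hsum : ∑ k, (Real.sqrt (P k) - b k) ^ 2 ≤ ε := by
    have h1 : ∀ k, (Real.sqrt (P k) - b k) ^ 2 = P k - 2 * (Real.sqrt (P k) * b k) + b k ^ 2 := by
      intro k
      rw [sub_sq, Real.sq_sqrt (hP k)]
      ring
    simp only [h1, Finset.sum_add_distrib, Finset.sum_sub_distrib, ← Finset.mul_sum, hP1]
    linarith
  -- At a key of probability above `4 / N` the amplitude `b k` is at most `√(P k) / 2`, so `P k` is
  -- at most four times the squared deviation. The total heavy mass is thus at most `4 ε`.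
  let heavy : κ → ℝ := fun k => if 4 / N < P k then P k else 0
  have hheavy : ∀ k, heavy k ≤ 4 * (Real.sqrt (P k) - b k) ^ 2 := by
    intro k
    simp only [heavy]
    split_ifs with hk
    · have h1 : b k ≤ Real.sqrt (P k) / 2 := by
        refine (abs_le_of_sq_le_sq' (a := b k) ?_ (by positivity)).2
        rw [div_pow, Real.sq_sqrt (hP k)]
        refine (hbN k).trans ?_
        rw [div_lt_iff₀ hN0] at hk
        rw [div_le_div_iff₀ hN0 (by norm_num)]
        linarith
      have h2 : (Real.sqrt (P k) / 2) ^ 2 ≤ (Real.sqrt (P k) - b k) ^ 2 :=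
        pow_le_pow_left₀ (by positivity) (by linarith) 2
      rw [div_pow, Real.sq_sqrt (hP k)] at h2
      linarith
    · positivity
  have hhs : ∑ k, heavy k ≤ 4 * ε := by
    refine (Finset.sum_le_sum fun k _ => hheavy k).trans ?_
    rw [← Finset.mul_sum]
    linarith
  have hh0 : 0 ≤ ∑ k, heavy k := Finset.sum_nonneg fun k _ => by
    simp only [heavy]
    split_ifs
    · exact hP k
    · exact le_rfl
  have hP1' : ∀ k, P k ≤ 1 := fun k => by
    rw [← hP1]
    exact Finset.single_le_sum (fun j _ => hP j) (Finset.mem_univ k)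
  -- Light keys contribute at least `log (N / 4) = log N - 2` per unit of mass; heavy ones
  -- contribute a nonnegative amount.
  have hent : ∀ k, (P k - heavy k) * (Real.logb 2 N - 2) ≤ P k * Real.logb 2 (1 / P k) := by
    intro k
    rcases (hP k).eq_or_lt with h0 | h0
    · simp only [heavy, ← h0]
      simp
    simp only [heavy]
    split_ifs with hk
    · rw [sub_self, zero_mul]
      refine mul_nonneg (hP k) (Real.logb_nonneg one_lt_two ?_)
      rw [le_div_iff₀ h0, one_mul]
      exact hP1' k
    · rw [sub_zero]
      refine mul_le_mul_of_nonneg_left ?_ (hP k)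
      have h4 : Real.logb 2 4 = 2 := by
        rw [show (4 : ℝ) = 2 ^ (2 : ℕ) by norm_num, Real.logb_pow, Real.logb_self_eq_one one_lt_two]
        norm_num
      have h6 : Real.logb 2 N - 2 = Real.logb 2 (N / 4) := by
        rw [Real.logb_div hN0.ne' (by norm_num), h4]
      rw [h6]
      refine Real.logb_le_logb_of_le one_lt_two (by positivity) ?_
      rw [not_lt, le_div_iff₀ hN0] at hk
      rw [div_le_div_iff₀ (by norm_num) h0]
      linarith
  have h5 := Finset.sum_le_sum fun k (_ : k ∈ Finset.univ) => hent k
  rw [← Finset.sum_mul, Finset.sum_sub_distrib, hP1] at h5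
  refine le_trans ?_ h5
  -- The heavy mass lies between `0` and `4 ε`, which would already give the factor `1 - 4 ε`; the
  -- stated `1 - 8 ε` is weaker.
  nlinarith

/-- Each message `x` gives an overlap between `P` and weights bounded by `tr (τ M k x)`. A single
such weight may be large, but for fixed `k` they sum over `x` to `tr τ = 1`, so the average over the
messages is at most `1 / N`. -/
theorem le_entropy_of_randomizing {τ : Matrix ι ι ℂ} (hτ : IsDensity τ) {P : κ → ℝ}
    (hP : ∀ k, 0 ≤ P k) (hP1 : ∑ k, P k = 1) {ρ : X → κ → Matrix ι ι ℂ}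
    (hρ : ∀ x k, IsDensity (ρ x k))
    (hM : ∀ k, 0 < P k → ∃ M : X → Matrix ι ι ℂ, (∀ x, (M x).PosSemidef) ∧ ∑ x, M x = 1 ∧
      ∀ x, M x * ρ x k = ρ x k) {ε : ℝ}
    (h : ∀ x, TrLE (∑ k, (P k : ℂ) • ρ x k - τ) ε) :
    (1 - 8 * ε) * Real.logb 2 (Fintype.card X) - 2 ≤ entropy P := by
  classical
  have hM' : ∀ k, ∃ M : X → Matrix ι ι ℂ, 0 < P k → (∀ x, (M x).PosSemidef) ∧ ∑ x, M x = 1 ∧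
      ∀ x, M x * ρ x k = ρ x k := by
    intro k
    by_cases hk : 0 < P k
    · obtain ⟨M, h⟩ := hM k hk
      exact ⟨M, fun _ => h⟩
    · exact ⟨0, fun h => absurd h hk⟩
  choose M hM using hM'
  choose f r hf hr hr0 hfr hfM using fun x => exists_overlap hτ hP hP1 (hρ x) (M := fun k => M k x)
    (fun k hk => (hM k hk).1 x) (fun k hk => (hM k hk).2.2 x) (h x)
  obtain ⟨N, hNdef⟩ : ∃ N : ℝ, N = Fintype.card X := ⟨_, rfl⟩
  have hN : 1 ≤ N := by
    rw [hNdef]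
    exact_mod_cast Fintype.card_pos (α := X)
  have hN0 : 0 < N := by linarith
  rw [← hNdef]
  -- The amplitude fed to `le_entropy_of_overlap` is `F k / √(P k)`. By convexity of the square, the
  -- bounds on the `f x k` survive averaging over `x`.
  let F : κ → ℝ := fun k => (∑ x, f x k) / N
  have hF2 : ∀ k, F k ^ 2 ≤ (∑ x, f x k ^ 2) / N := by
    intro k
    have h1 := sq_sum_le_card_mul_sum_sq (s := (Finset.univ : Finset X)) (f := fun x => f x k)
    rw [Finset.card_univ, ← hNdef] at h1
    rw [div_pow, div_le_div_iff₀ (by positivity) hN0]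
    nlinarith
  -- For `P k = 0` the quotient is `0` by convention, and `F k` vanishes too because `f x k ^ 2 ≤ P
  -- k * r x k`.
  have hb : ∀ k, Real.sqrt (P k) * (F k / Real.sqrt (P k)) = F k := by
    intro k
    rcases (hP k).eq_or_lt with h0 | h0
    · have h1 : F k ^ 2 ≤ 0 := by
        refine (hF2 k).trans (div_nonpos_of_nonpos_of_nonneg (Finset.sum_nonpos fun x _ => ?_) hN0.le)
        have := hfr x k
        rwa [← h0, zero_mul] at this
      have h2 : F k = 0 := pow_eq_zero_iff two_ne_zero |>.1 (le_antisymm h1 (sq_nonneg _))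
      simp [h2]
    · exact mul_div_cancel₀ _ (Real.sqrt_pos.2 h0).ne'
  have hbound : ∀ k, ∀ g : X → ℝ, 0 < P k → (∀ x, f x k ^ 2 ≤ P k * g x) →
      (F k / Real.sqrt (P k)) ^ 2 ≤ (∑ x, g x) / N := by
    intro k g hk hg
    rw [div_pow, Real.sq_sqrt hk.le, div_le_iff₀ hk]
    refine (hF2 k).trans ?_
    rw [div_mul_eq_mul_div, Finset.sum_mul]
    refine div_le_div_of_nonneg_right (Finset.sum_le_sum fun x _ => ?_) hN0.le
    rw [mul_comm]
    exact hg x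
  refine le_entropy_of_overlap (b := fun k => F k / Real.sqrt (P k)) hP hP1 hN
    (h (Classical.arbitrary X)).nonneg ?_ (fun k => ?_) ?_
  · calc ∑ k, (F k / Real.sqrt (P k)) ^ 2 ≤ ∑ k, (∑ x, r x k) / N := by
          refine Finset.sum_le_sum fun k _ => ?_
          rcases (hP k).eq_or_lt with h0 | h0
          · simp only [← h0, Real.sqrt_zero, div_zero]
            rw [zero_pow two_ne_zero]
            exact div_nonneg (Finset.sum_nonneg fun x _ => hr0 x k) hN0.le
          · exact hbound k _ h0 fun x => hfr x k
      _ ≤ (∑ x : X, 1) / N := by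
          rw [← Finset.sum_div, Finset.sum_comm]
          exact div_le_div_of_nonneg_right (Finset.sum_le_sum fun x _ => hr x) hN0.le
      _ = 1 := by
          rw [Finset.sum_const, Finset.card_univ, nsmul_eq_mul, mul_one, ← hNdef,
            div_self hN0.ne']
  · rcases (hP k).eq_or_lt with h0 | h0
    · simp only [← h0, Real.sqrt_zero, div_zero]
      rw [zero_pow two_ne_zero]
      positivity
    · refine (hbound k _ h0 fun x => hfM x k h0).trans (le_of_eq ?_)
      rw [← Complex.re_sum, ← Matrix.trace_sum, ← Matrix.mul_sum, (hM k h0).2.1, Matrix.mul_one,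
        hτ.2, Complex.one_re]
  · simp only [hb, F]
    rw [← Finset.sum_div, Finset.sum_comm, le_div_iff₀ hN0]
    calc (1 - ε / 2) * N = ∑ x : X, (1 - ε / 2) := by
          rw [Finset.sum_const, Finset.card_univ, nsmul_eq_mul, ← hNdef, mul_comm]
      _ ≤ _ := Finset.sum_le_sum fun x _ => hf x

/-- Only basis messages are needed: there are `d ^ t` of them, with logarithm `t log d`, and the
decoder followed by a basis measurement distinguishes their ciphers. -/
theorem QSR.Randomizing.le_keyEntropy {K C : Type} [Fintype K] [DecidableEq K] [Fintype C]
    [DecidableEq C] {t d : ℕ} {ε : ℝ} {T : QSR κ K (Fin d) C} (hd : 0 < d) (hT : T.Invertible)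
    (h : T.Randomizing t ε) : (1 - 8 * ε) * t * Real.logb 2 d - 2 ≤ T.keyEntropy := by
  obtain ⟨τ, hτ, h⟩ := h
  have : Nonempty (Fin d) := ⟨⟨0, hd⟩⟩
  have hσ : ∀ x : Fin t → Fin d, ∀ i, IsDensity (proj (x i)) := fun x i => isDensity_proj _
  have key := le_entropy_of_randomizing (X := Fin t → Fin d) hτ T.prob_nonneg T.prob_sum
    (ρ := fun x k => tensorPow fun i => T.cipher k (proj (x i)))
    (fun x k => IsDensity.tensorPow fun i => T.isDensity_cipher k (hσ x i)) (ε := ε)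
    (fun k hk => ?_)
    (fun x => (trLE_iff ((T.isDensity_averageCipher (hσ x)).isHermitian.sub
      hτ.isHermitian)).2 (h _ (hσ x)))
  · rw [Fintype.card_fun, Fintype.card_fin, Fintype.card_fin, Nat.cast_pow, Real.logb_pow,
      ← mul_assoc] at key
    exact key
  obtain ⟨D, ⟨r, _, V, hV, hV1⟩, hD⟩ := hT k hk
  -- The Heisenberg dual of the decoder applied to `|j⟩⟨j|`: the effect "decodes to `j`".
  let E : Fin d → Matrix C C ℂ := fun j => ∑ a, (V a).conjTranspose * proj j * V a
  have hE : ∀ j, (E j).PosSemidef := fun j =>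
    Matrix.posSemidef_sum _ fun a _ => (posSemidef_proj j).conjTranspose_mul_mul_same (V a)
  have hE1 : ∑ j, E j = 1 := by
    have h1 : ∑ j : Fin d, proj j = (1 : Matrix (Fin d) (Fin d) ℂ) := by
      ext i j
      simp [proj, Matrix.sum_apply, Matrix.single_apply, Matrix.one_apply, ite_and]
    rw [← hV1, Finset.sum_comm]
    refine Finset.sum_congr rfl fun a _ => ?_
    rw [← Matrix.sum_mul, ← Matrix.mul_sum, h1, Matrix.mul_one]
  -- Correct decoding gives the effect probability one, so `1 - E j` has zero trace against the
  -- cipher and annihilates it.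
  have hEρ : ∀ j, E j * T.cipher k (proj j) = T.cipher k (proj j) := by
    intro j
    have h1 : (E j * T.cipher k (proj j)).trace = 1 := by
      have h2 : (E j * T.cipher k (proj j)).trace = (proj j * D (T.cipher k (proj j))).trace := by
        rw [hV, Matrix.mul_sum, Matrix.trace_sum, Matrix.sum_mul, Matrix.trace_sum]
        refine Finset.sum_congr rfl fun a _ => ?_
        rw [Matrix.mul_assoc, Matrix.mul_assoc, Matrix.trace_mul_comm]
        simp only [Matrix.mul_assoc]
      rw [h2, hD _ (isDensity_proj j)]
      simp [proj]
    have h3 : (1 - E j).PosSemidef := by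
      rw [← hE1, ← Finset.add_sum_erase _ _ (Finset.mem_univ j), add_sub_cancel_left]
      exact Matrix.posSemidef_sum _ fun i _ => hE i
    have h4 := mul_eq_zero_of_trace_mul_eq_zero h3 (T.isDensity_cipher k (isDensity_proj j)).1 (by
      rw [Matrix.sub_mul, Matrix.one_mul, Matrix.trace_sub, h1,
        (T.isDensity_cipher k (isDensity_proj j)).2, sub_self])
    rw [Matrix.sub_mul, Matrix.one_mul, sub_eq_zero] at h4
    exact h4.symm
  refine ⟨fun x => tensorPow fun i => E (x i), fun x => posSemidef_tensorPow fun i => hE _, ?_,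
    fun x => ?_⟩
  · rw [← tensorPow_sum (fun (_ : Fin t) j => E j), hE1, tensorPow_one]
  · rw [tensorPow_mul]
    exact congrArg tensorPow (funext fun i => hEρ (x i))

end LowerBound

/-! ### Parameters of the combined scheme -/

section Parameters

theorem combine_properties {t n m d e : ℕ} {ε₁ ε₂ : ℝ}
    {P : ClassicalKeyQSR (Bits m) (Fin d) (Fin e)} (hd : 0 < d)
    (hε₁ : ε₁ = (2 : ℝ) ^ ((t : ℝ) - n + 1)) (hI : P.Invertible) (hR : P.Randomizing ε₂) :
    (combine (linScheme m n) P).Invertible ∧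
    (combine (linScheme m n) P).Randomizing t (ε₁ + t * ε₂) ∧
    (combine (linScheme m n) P).Indistinguishable t (ε₁ + t * ε₂) ∧
    (combine (linScheme m n) P).ClassicalKeys ∧
    (combine (linScheme m n) P).keyEntropy = (t + Real.logb 2 (1 / ε₁) + 1) * m := by
  have h := combine_indistinguishable P hd hε₁ hR
  refine ⟨combine_invertible P hI, h.randomizing, h, combine_classicalKeys P, ?_⟩
  rw [combine_keyEntropy, hε₁, one_div, Real.logb_inv, Real.logb_rpow two_pos (by norm_num)]
  ring

/-- The logarithm of the condition `4 d ≤ 2 ^ m * ε ^ 2`; the constant `2` is `log 4`. -/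
theorem exists_pad_of_logb_le {m d : ℕ} {ε : ℝ} (hd : 0 < d) (hε : 0 < ε)
    (hm : Real.logb 2 d + 2 * Real.logb 2 (1 / ε) + 2 ≤ m) :
    ∃ (e : ℕ) (P : ClassicalKeyQSR (Bits m) (Fin d) (Fin e)),
      P.UniformKey ∧ P.Invertible ∧ P.Randomizing ε := by
  have hd' : (0 : ℝ) < d := Nat.cast_pos.2 hd
  refine exists_pad hd hε.le ?_
  have h4 : Real.logb 2 4 = 2 := by
    rw [show (4 : ℝ) = 2 ^ (2 : ℕ) by norm_num, Real.logb_pow, Real.logb_self_eq_one one_lt_two]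
    norm_num
  have h1 : Real.logb 2 (4 * d * (1 / ε) ^ 2) ≤ m := by
    rw [Real.logb_mul (by positivity) (by positivity), Real.logb_mul (by norm_num) hd'.ne',
      Real.logb_pow, h4]
    push_cast
    linarith
  rw [Real.logb_le_iff_le_rpow one_lt_two (by positivity), Real.rpow_natCast] at h1
  have h2 := mul_le_mul_of_nonneg_right h1 (sq_nonneg ε)
  rw [mul_assoc, ← mul_pow, one_div_mul_cancel hε.ne', one_pow, mul_one] at h2
  exact h2

theorem eq_rpow_of_natCast_eq {t n : ℕ} {ε : ℝ} (hε : 0 < ε)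
    (hn : (n : ℝ) = t + Real.logb 2 (1 / ε) + 1) : ε = (2 : ℝ) ^ ((t : ℝ) - n + 1) := by
  have h : (t : ℝ) - n + 1 = Real.logb 2 ε := by
    rw [hn, one_div, Real.logb_inv]
    ring
  rw [h, Real.rpow_logb two_pos (by norm_num) hε]

/-! ### Asymptotics of the key size. -/

variable {ι : Type} {l : Filter ι}

/-- Rounding `x + y` up to a natural number changes `x` by little if `y` is small. -/
theorem isLittleO_ceil_sub {x y : ι → ℝ} (c : ℕ) (hx : Tendsto x l atTop) (hy : y =o[l] x) :
    (fun j => ((⌈x j + y j⌉₊ + c : ℕ) : ℝ) - x j) =o[l] x := by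
  have hc : (fun _ : ι => (c + 1 : ℝ)) =o[l] x :=
    isLittleO_const_left.2 (Or.inr (tendsto_norm_atTop_atTop.comp hx))
  refine IsBigO.trans_isLittleO (IsBigO.of_bound 1 ?_) (hy.norm_left.add hc)
  filter_upwards [hx.eventually_ge_atTop 0] with j hj
  have h1 := Nat.le_ceil (x j + y j)
  have h2 : (⌈x j + y j⌉₊ : ℝ) ≤ x j + |y j| + 1 := by
    refine (Nat.cast_le.2 (Nat.ceil_le_ceil (add_le_add_right (le_abs_self (y j)) (x j)))).trans ?_
    exact (Nat.ceil_lt_add_one (add_nonneg hj (abs_nonneg _))).le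
  have h3 := neg_abs_le (y j)
  have h4 : (0 : ℝ) ≤ c := Nat.cast_nonneg c
  rw [one_mul, Real.norm_eq_abs, Real.norm_eq_abs, Real.norm_eq_abs,
    abs_of_nonneg (a := |y j| + (c + 1)) (by positivity), abs_le]
  push_cast
  constructor <;> linarith

/-- From `a b - x y = (a - x)(b - y) + (a - x) y + x (b - y)`. -/
theorem isLittleO_mul_sub_mul {a b x y : ι → ℝ} (ha : (fun j => a j - x j) =o[l] x)
    (hb : (fun j => b j - y j) =o[l] y) :
    (fun j => a j * b j - x j * y j) =o[l] fun j => x j * y j := by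
  have h := ((ha.mul hb).add (ha.mul_isBigO (isBigO_refl y l))).add
    ((isBigO_refl x l).mul_isLittleO hb)
  refine h.congr_left fun j => ?_
  ring

/-- As `ε → 0` and `L → ∞`, both `8 ε L` and `2` are `o(L)`, so numerator and denominator are each
equivalent to `L`. -/
theorem tendsto_div_lowerBound {H L ε : ι → ℝ} (hL : Tendsto L l atTop)
    (hH : (fun j => H j - L j) =o[l] L) (hε : Tendsto ε l (𝓝 0)) :
    Tendsto (fun j => H j / ((1 - 8 * ε j) * L j - 2)) l (𝓝 1) := by
  have h2 : (fun _ : ι => (2 : ℝ)) =o[l] L :=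
    isLittleO_const_left.2 (Or.inr (tendsto_norm_atTop_atTop.comp hL))
  have hεo : (fun j => ε j * L j) =o[l] L := by
    have := ((isLittleO_one_iff ℝ).2 hε).mul_isBigO (isBigO_refl L l)
    simpa using this
  have hD : (fun j => (1 - 8 * ε j) * L j - 2) ~[l] L := by
    refine ((hεo.const_mul_left (-8)).sub h2).congr_left fun j => ?_
    simp only [Pi.sub_apply]
    ring
  have hDt := hD.symm.tendsto_atTop hL
  have hHD : H ~[l] fun j => (1 - 8 * ε j) * L j - 2 :=
    IsEquivalent.trans (show H ~[l] L from hH) hD.symm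
  exact (isEquivalent_iff_tendsto_one (hDt.eventually_ne_atTop 0)).1 hHD

theorem exists_optimal_combination {t d : ι → ℕ} {ε₁ ε₂ : ι → ℝ} (ht : Tendsto t l atTop)
    (hd : Tendsto d l atTop) (hε : ∀ᶠ j in l, 0 < ε₁ j ∧ 0 < ε₂ j)
    (h₁ : (fun j => Real.logb 2 (1 / ε₁ j)) =o[l] (fun j => (t j : ℝ)))
    (h₂ : (fun j => Real.logb 2 (1 / ε₂ j)) =o[l] (fun j => Real.logb 2 (d j))) :
    ∃ H : ι → ℝ,
      (∀ᶠ j in l, ∃ (n m e : ℕ) (P : ClassicalKeyQSR (Bits m) (Fin (d j)) (Fin e)),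
        P.UniformKey ∧ P.Invertible ∧ P.Randomizing (ε₂ j) ∧
        (combine (linScheme m n) P).Invertible ∧
        (combine (linScheme m n) P).Randomizing (t j) (ε₁ j + t j * ε₂ j) ∧
        (combine (linScheme m n) P).Indistinguishable (t j) (ε₁ j + t j * ε₂ j) ∧
        (combine (linScheme m n) P).ClassicalKeys ∧
        (combine (linScheme m n) P).keyEntropy = H j) ∧
      (fun j => H j - t j * Real.logb 2 (d j)) =o[l] (fun j => t j * Real.logb 2 (d j)) ∧
      (Tendsto (fun j => ε₁ j + t j * ε₂ j) l (𝓝 0) →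
        Tendsto (fun j => H j /
          ((1 - 8 * (ε₁ j + t j * ε₂ j)) * t j * Real.logb 2 (d j) - 2)) l (𝓝 1)) := by
  have ht' : Tendsto (fun j => (t j : ℝ)) l atTop := tendsto_natCast_atTop_atTop.comp ht
  have hd' : Tendsto (fun j => Real.logb 2 (d j)) l atTop :=
    (Real.tendsto_logb_atTop one_lt_two).comp (tendsto_natCast_atTop_atTop.comp hd)
  -- The requirements `2 ^ (t - n + 1) ≤ ε₁` and `4 d ≤ 2 ^ m ε₂²` rounded up. The ceiling is in
  -- `ℕ`, so a negative argument gives `0`, which still bounds it from above.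
  let n : ι → ℕ := fun j => ⌈(t j : ℝ) + Real.logb 2 (1 / ε₁ j)⌉₊ + 1
  let m : ι → ℕ := fun j => ⌈Real.logb 2 (d j) + 2 * Real.logb 2 (1 / ε₂ j)⌉₊ + 2
  have hH : (fun j => (n j : ℝ) * m j - t j * Real.logb 2 (d j)) =o[l]
      (fun j => t j * Real.logb 2 (d j)) :=
    isLittleO_mul_sub_mul (isLittleO_ceil_sub 1 ht' h₁)
      (isLittleO_ceil_sub 2 hd' (h₂.const_mul_left 2))
  refine ⟨fun j => n j * m j, ?_, hH, fun h => ?_⟩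
  · filter_upwards [hε, hd.eventually_gt_atTop 0] with j hj hdj
    obtain ⟨e, P, hU, hI, hR⟩ := exists_pad_of_logb_le (m := m j) hdj hj.2 (by
      simp only [m, Nat.cast_add, Nat.cast_ofNat]
      exact add_le_add_left (Nat.le_ceil _) 2)
    -- Applied with the exact error `2 ^ (t - n + 1)` of the rounded `n`, which is then relaxed to
    -- `ε₁`.
    obtain ⟨k1, k2, k3, k4, -⟩ := combine_properties (t := t j) (n := n j) hdj rfl hI hR
    have hle : (2 : ℝ) ^ ((t j : ℝ) - n j + 1) + t j * ε₂ j ≤ ε₁ j + t j * ε₂ j := by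
      refine add_le_add_left ?_ _
      rw [← Real.le_logb_iff_rpow_le one_lt_two hj.1]
      have h3 := Nat.le_ceil ((t j : ℝ) + Real.logb 2 (1 / ε₁ j))
      rw [one_div, Real.logb_inv] at h3
      simp only [n, one_div, Real.logb_inv]
      push_cast
      linarith
    exact ⟨n j, m j, e, P, hU, hI, hR, k1, k2.mono hle, k3.mono hle, k4, combine_keyEntropy P⟩
  · have := tendsto_div_lowerBound (ht'.atTop_mul_atTop₀ hd') hH h
    simpa only [mul_assoc] using this

end Parameters

end QKey

theorem mainTheorem6 :
    -- the combination, for an arbitrary one-time pad whose key is a string of `m` bits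
    (∀ (t n m d e : ℕ) (ε₁ ε₂ : ℝ) (P : QKey.ClassicalKeyQSR (QKey.Bits m) (Fin d) (Fin e)),
      0 < d → t < n → ε₁ = (2 : ℝ) ^ ((t : ℝ) - n + 1) → P.Invertible → P.Randomizing ε₂ →
        (QKey.combine (QKey.linScheme m n) P).Invertible ∧
        (QKey.combine (QKey.linScheme m n) P).Randomizing t (ε₁ + t * ε₂) ∧
        (QKey.combine (QKey.linScheme m n) P).Indistinguishable t (ε₁ + t * ε₂) ∧
        (QKey.combine (QKey.linScheme m n) P).ClassicalKeys ∧
        (QKey.combine (QKey.linScheme m n) P).keyEntropy =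
          (t + Real.logb 2 (1 / ε₁) + 1) * m) ∧
    -- the combination with an approximate one-time pad of the claimed key length
    (∀ (t n m d : ℕ) (ε₁ ε₂ : ℝ), 0 < d → t < n → 0 < ε₁ → 0 < ε₂ →
      (n : ℝ) = t + Real.logb 2 (1 / ε₁) + 1 →
      (m : ℝ) = Real.logb 2 d + 2 * Real.logb 2 (1 / ε₂) + 4 →
        ∃ (e : ℕ) (P : QKey.ClassicalKeyQSR (QKey.Bits m) (Fin d) (Fin e)),
          P.UniformKey ∧ P.Invertible ∧ P.Randomizing ε₂ ∧
          (QKey.combine (QKey.linScheme m n) P).Invertible ∧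
          (QKey.combine (QKey.linScheme m n) P).Randomizing t (ε₁ + t * ε₂) ∧
          (QKey.combine (QKey.linScheme m n) P).Indistinguishable t (ε₁ + t * ε₂) ∧
          (QKey.combine (QKey.linScheme m n) P).ClassicalKeys ∧
          (QKey.combine (QKey.linScheme m n) P).keyEntropy =
            (t + Real.logb 2 (1 / ε₁) + 1) *
              (Real.logb 2 d + 2 * Real.logb 2 (1 / ε₂) + 4)) ∧
    -- the lower bound, for all schemes with quantum keys
    (∀ (κ K C : Type) [Fintype κ] [Fintype K] [DecidableEq K] [Fintype C] [DecidableEq C]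
      (t d : ℕ) (ε : ℝ) (T : QKey.QSR κ K (Fin d) C), 0 < d → T.Invertible →
        (T.Randomizing t ε ∨ T.Indistinguishable t ε) →
          (1 - 8 * ε) * t * Real.logb 2 d - 2 ≤ T.keyEntropy) ∧
    -- the key size of the combined scheme is `t log d + o(t log d)` and matches the lower bound
    (∀ (ι : Type) (l : Filter ι) (t d : ι → ℕ) (ε₁ ε₂ : ι → ℝ),
      Tendsto t l atTop → Tendsto d l atTop → (∀ᶠ j in l, 0 < ε₁ j ∧ 0 < ε₂ j) →
      (fun j => Real.logb 2 (1 / ε₁ j)) =o[l] (fun j => (t j : ℝ)) →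
      (fun j => Real.logb 2 (1 / ε₂ j)) =o[l] (fun j => Real.logb 2 (d j)) →
        ∃ H : ι → ℝ,
          (∀ᶠ j in l, ∃ (n m e : ℕ)
            (P : QKey.ClassicalKeyQSR (QKey.Bits m) (Fin (d j)) (Fin e)),
              P.UniformKey ∧ P.Invertible ∧ P.Randomizing (ε₂ j) ∧
              (QKey.combine (QKey.linScheme m n) P).Invertible ∧
              (QKey.combine (QKey.linScheme m n) P).Randomizing (t j) (ε₁ j + t j * ε₂ j) ∧
              (QKey.combine (QKey.linScheme m n) P).Indistinguishable (t j)
                (ε₁ j + t j * ε₂ j) ∧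
              (QKey.combine (QKey.linScheme m n) P).ClassicalKeys ∧
              (QKey.combine (QKey.linScheme m n) P).keyEntropy = H j) ∧
          (fun j => H j - t j * Real.logb 2 (d j)) =o[l] (fun j => t j * Real.logb 2 (d j)) ∧
          (Tendsto (fun j => ε₁ j + t j * ε₂ j) l (𝓝 0) →
            Tendsto (fun j => H j /
              ((1 - 8 * (ε₁ j + t j * ε₂ j)) * t j * Real.logb 2 (d j) - 2)) l (𝓝 1))) := by
  refine ⟨fun t n m d e ε₁ ε₂ P hd _ hε₁ hI hR => QKey.combine_properties hd hε₁ hI hR,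
    fun t n m d ε₁ ε₂ hd _ h₁ h₂ hn hm => ?_, fun κ K C _ _ _ _ _ t d ε T hd hT h => ?_,
    fun ι l t d ε₁ ε₂ ht hd hε h₁ h₂ => QKey.exists_optimal_combination ht hd hε h₁ h₂⟩
  -- The pad needs only the additive constant `2`, so the `4` in the prescribed key length leaves
  -- room.
  · obtain ⟨e, P, hU, hI, hR⟩ := QKey.exists_pad_of_logb_le hd h₂
      (by rw [hm]; exact add_le_add_right (by norm_num) _)
    obtain ⟨k1, k2, k3, k4, k5⟩ :=
      QKey.combine_properties hd (QKey.eq_rpow_of_natCast_eq h₁ hn) hI hR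
    exact ⟨e, P, hU, hI, hR, k1, k2, k3, k4, by rw [k5, hm]⟩
  · classical
    exact (h.elim id fun h => h.randomizing).le_keyEntropy hd hT
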